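/- Let $g,k,m\ge 1$ be integers and let $p$ be a prime. Let $\mathbb{Q}_p^{\mathrm{ur}}$ be the maximal unramified extension of $\mathbb{Q}_p$, let $\mathcal{O}_{\mathfrak p}$ be its local ring of integers and $\mathfrak{p}$ the non-zero prime ideal of $\mathcal{O}_{\mathfrak p}$, and fix an embedding $\mathbb{Q}_p^{\mathrm{ur}}\hookrightarrow\mathbb{C}$. Let $\mathrm{M}^{(g)}_{k}$ be the space of (scalar-valued) Siegel modular forms $F(Z)=\sum_{T\ge 0}c(T)\,e^{2\pi i\,\mathrm{tr}(TZ)}$ of degree $g$ and weight $k$ for $\mathrm{Sp}_g(\mathbb{Z})$, and let $\mathrm{J}^{(g)}_{k,m}$ be the space of Jacobi forms $\phi(\tau,z)=\sum_{T,R}c(T,R)\,e^{2\pi i(\mathrm{tr}(T\tau)+zR)}$ of degree $g$, weight $k$ and index $m$ for $\mathrm{Sp}_g(\mathbb{Z})\ltimes\mathbb{Z}^{2g}$ (the sum running over $T\ge 0$ and $R$ with $4mT-R\,{}^{t}\!R\ge 0$), in both cases with all Fourier coefficients in $\mathcal{O}_{\mathfrak p}$. Such a form is $\equiv 0 \pmod{\mathfrak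 p}$ if all its Fourier coefficients lie in $\mathfrak p$. The diagonal vanishing order $\mathrm{ord}_{\mathfrak p}F$ (resp. $\mathrm{ord}_{\mathfrak p}\,\phi$) of a form that is $\not\equiv 0\pmod{\mathfrak p}$ is the largest integer $l\ge 0$ such that $c(T)\equiv 0\pmod{\mathfrak p}$ (resp. $c(T,R)\equiv 0\pmod{\mathfrak p}$ for all $R$) for all $T=(t_{ij})$ with $t_{ii}\le l$ for all $1\le i\le g$; it is $0$ if there is no such $l$, and it is $\infty$ if the form is $\equiv 0\pmod{\mathfrak p}$. The mod $\mathfrak p$ diagonal slope bound for degree $g$ is $$\varrho^{(g)}_{\mathrm{diag},\mathfrak p}:=\inf_{k\ge 1}\ \inf_{\substack{F\in \mathrm{M}^{(g)}_{k}\\ F\not\equiv 0\ (\mathrm{mod}\ \mathfrak p)}}\frac{k}{\mathrm{ord}_{\mathfrak p}F},$$ where $k/0=\infty$. **Proposition.** Suppose that a mod $\mathfrak p$ diagonal slope bound for degree $g$ exists, i.e. $\varrho^{(g)}_{\mathrm{diag},\mathfrak p}>0$. Let $\phi\in \mathrm{J}^{(g)}_{k,m}$ be such that $$\mathrm{ord}_{\mathfrak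 p}\,\phi>\frac{m}{4}+\frac{k}{\varrho^{(g)}_{\mathrm{diag},\mathfrak p}}.$$ Then $\phi\equiv 0\pmod{\mathfrak p}$. -/

import Mathlib

open scoped ENNReal

noncomputable section

namespace SturmSlope

/-! ### The maximal unramified extension of `ℚ_p` and its valuation ring -/

/-- A subextension `K / ℚ_p` of the algebraic closure is *unramified* if its ring of integers
(the integral closure of `ℤ_p` in `K`) is unramified over `ℤ_p`. -/
def IsUnramifiedExt (p : ℕ) [Fact p.Prime] (K : IntermediateField ℚ_[p] (PadicAlgCl p)) : Prop :=
  Algebra.FormallyUnramified ℤ_[p] (integralClosure ℤ_[p] K)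

/-- The maximal unramified extension `ℚ_p^ur`: the compositum, inside the algebraic closure of
`ℚ_p`, of all finite unramified extensions of `ℚ_p`. -/
def Qpur (p : ℕ) [Fact p.Prime] : IntermediateField ℚ_[p] (PadicAlgCl p) :=
  ⨆ (K : IntermediateField ℚ_[p] (PadicAlgCl p))
    (_ : FiniteDimensional ℚ_[p] K ∧ IsUnramifiedExt p K), K

/-- The local ring `O_𝔭` of `ℚ_p^ur`, i.e. its valuation ring (the elements of `p`-adic absolute
value at most `1`). -/
def Op (p : ℕ) [Fact p.Prime] : ValuationSubring (Qpur p) :=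
  (Valued.v (R := PadicAlgCl p)).valuationSubring.comap (algebraMap (Qpur p) (PadicAlgCl p))

/-- The prime `𝔭` of `ℚ_p^ur`: the maximal ideal of the local ring `O_𝔭`, which is its only
non-zero prime ideal. -/
def primeP (p : ℕ) [Fact p.Prime] : Ideal (Op p) := IsLocalRing.maximalIdeal (Op p)

/-! ### The Siegel upper half space and the action of the symplectic group -/

/-- The Siegel upper half space of degree `g`: symmetric complex matrices with positive definite
imaginary part. -/
def siegelH (g : ℕ) : Set (Matrix (Fin g) (Fin g) ℂ) :=
  {Z | Z.IsSymm ∧ (Z.map Complex.im).PosDef}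

/-- The matrix `C Z + D`, for `M = (A B; C D)`. -/
def denom {g : ℕ} (M : Matrix (Fin g ⊕ Fin g) (Fin g ⊕ Fin g) ℤ) (Z : Matrix (Fin g) (Fin g) ℂ) :
    Matrix (Fin g) (Fin g) ℂ :=
  M.toBlocks₂₁.map (Int.cast : ℤ → ℂ) * Z + M.toBlocks₂₂.map (Int.cast : ℤ → ℂ)

/-- The matrix `(A Z + B) (C Z + D)⁻¹`, for `M = (A B; C D)`. -/
def moebius {g : ℕ} (M : Matrix (Fin g ⊕ Fin g) (Fin g ⊕ Fin g) ℤ)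
    (Z : Matrix (Fin g) (Fin g) ℂ) : Matrix (Fin g) (Fin g) ℂ :=
  (M.toBlocks₁₁.map (Int.cast : ℤ → ℂ) * Z + M.toBlocks₁₂.map (Int.cast : ℤ → ℂ)) * (denom M Z)⁻¹

/-- `e(x) = exp (2 π i x)`. -/
def e (x : ℂ) : ℂ := Complex.exp (2 * Real.pi * Complex.I * x)

/-! ### Siegel modular forms -/

/-- A Siegel modular form of degree `g` and weight `k` for the full group `Sp_g(ℤ)`, of trivial
type, with Fourier coefficients in `O_𝔭`; here `ι` embeds `ℚ_p^ur` into `ℂ`. Only the values of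
`toFun` on the Siegel upper half space matter. (That set spans the space of symmetric matrices and
is open in it, so that differentiability within it is holomorphy.) The Fourier coefficients
`coeff` are indexed by all rational matrices and vanish unless the index is symmetric and positive
semi-definite; they are determined by the function. -/
structure SiegelModularForm (p : ℕ) [Fact p.Prime] (ι : Qpur p →+* ℂ) (g k : ℕ) where
  toFun : Matrix (Fin g) (Fin g) ℂ → ℂ
  coeff : Matrix (Fin g) (Fin g) ℚ → Op p
  holo : DifferentiableOn ℂ toFun (siegelH g)
  transf : ∀ M ∈ Matrix.symplecticGroup (Fin g) ℤ, ∀ Z ∈ siegelH g,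
    toFun (moebius M Z) = (denom M Z).det ^ k * toFun Z
  coeff_supp : ∀ T, coeff T ≠ 0 → T.IsSymm ∧ (T.map (Rat.cast : ℚ → ℝ)).PosSemidef
  hasSum : ∀ Z ∈ siegelH g,
    HasSum (fun T : Matrix (Fin g) (Fin g) ℚ =>
      ι (coeff T : Qpur p) * e (T.map (Rat.cast : ℚ → ℂ) * Z).trace) (toFun Z)

namespace SiegelModularForm

variable {p : ℕ} [Fact p.Prime] {ι : Qpur p →+* ℂ} {g k : ℕ}

/-- `F ≡ 0 (mod 𝔭)`: all Fourier coefficients of `F` lie in `𝔭`. -/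
def IsZeroMod (F : SiegelModularForm p ι g k) : Prop :=
  ∀ T, F.coeff T ∈ primeP p

/-- The mod `𝔭` diagonal vanishing order of `F`: the largest integer `l ≥ 0` such that
`c(T) ≡ 0 (mod 𝔭)` for all `T` whose diagonal entries are all at most `l`.
For `F ≢ 0 (mod 𝔭)` this is a natural number, equal to `0` if there is no such `l`. -/
def diagOrd (F : SiegelModularForm p ι g k) : ℕ∞ :=
  ⨆ (l : ℕ) (_ : ∀ T : Matrix (Fin g) (Fin g) ℚ, (∀ i, T i i ≤ l) → F.coeff T ∈ primeP p), (l : ℕ∞)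

end SiegelModularForm

/-- The mod `𝔭` diagonal slope bound for degree `g` scalar-valued Siegel modular forms: the
infimum of `k / ord_𝔭 F` over all weights `k ≥ 1` and all forms `F ≢ 0 (mod 𝔭)` of degree `g`,
weight `k` and with coefficients in `O_𝔭`. Forms with `ord_𝔭 F = 0` contribute `k / 0 = ∞`. -/
def diagSlopeBound (p : ℕ) [Fact p.Prime] (ι : Qpur p →+* ℂ) (g : ℕ) : ℝ≥0∞ :=
  ⨅ (k : ℕ) (_ : 1 ≤ k) (F : SiegelModularForm p ι g k) (_ : ¬ F.IsZeroMod),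
    (k : ℝ≥0∞) / (F.diagOrd : ℝ≥0∞)

/-! ### Jacobi forms -/

open Matrix in
/-- The weight `k`, index `m` slash action of the element `[M, (lam, mu), 0]` of the Jacobi group
on functions on `ℍ_g × ℂ^g`. With `M = (A B; C D)` and `w = z + lam τ + mu` it is
`det(C τ + D)^(-k) · e(m (- w (C τ + D)⁻¹ C wᵗ + lam τ lamᵗ + 2 lam zᵗ + mu lamᵗ))
  · φ((A τ + B)(C τ + D)⁻¹, w (C τ + D)⁻¹)`. -/
def jacobiSlash {g : ℕ} (k m : ℕ) (φ : Matrix (Fin g) (Fin g) ℂ × (Fin g → ℂ) → ℂ)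
    (M : Matrix (Fin g ⊕ Fin g) (Fin g ⊕ Fin g) ℤ) (lam mu : Fin g → ℤ)
    (τ : Matrix (Fin g) (Fin g) ℂ) (z : Fin g → ℂ) : ℂ :=
  let lam' : Fin g → ℂ := fun i => (lam i : ℂ)
  let mu' : Fin g → ℂ := fun i => (mu i : ℂ)
  let w : Fin g → ℂ := z + lam' ᵥ* τ + mu'
  ((denom M τ).det ^ k)⁻¹
    * e (m * (-((w ᵥ* ((denom M τ)⁻¹ * M.toBlocks₂₁.map (Int.cast : ℤ → ℂ))) ⬝ᵥ w)
        + (lam' ᵥ* τ) ⬝ᵥ lam' + 2 * (lam' ⬝ᵥ z) + mu' ⬝ᵥ lam'))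
    * φ (moebius M τ, w ᵥ* (denom M τ)⁻¹)

/-- A Jacobi form of degree `g`, weight `k` and index `m` (of trivial type) with Fourier
coefficients in `O_𝔭`; here `ι` embeds `ℚ_p^ur` into `ℂ`. Only the values of `toFun` on
`ℍ_g × ℂ^g` matter. The Fourier coefficients `coeff T R` are indexed by all rational matrices `T`
and rational vectors `R`, and vanish unless `T` is symmetric and both `T` and `4 m T - R Rᵗ` are
positive semi-definite; they are determined by the function. -/
structure JacobiForm (p : ℕ) [Fact p.Prime] (ι : Qpur p →+* ℂ) (g k m : ℕ) where
  toFun : Matrix (Fin g) (Fin g) ℂ × (Fin g → ℂ) → ℂ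
  coeff : Matrix (Fin g) (Fin g) ℚ → (Fin g → ℚ) → Op p
  holo : DifferentiableOn ℂ toFun (siegelH g ×ˢ Set.univ)
  invariant : ∀ M ∈ Matrix.symplecticGroup (Fin g) ℤ, ∀ lam mu : Fin g → ℤ, ∀ τ ∈ siegelH g,
    ∀ z : Fin g → ℂ, jacobiSlash k m toFun M lam mu τ z = toFun (τ, z)
  coeff_supp : ∀ T R, coeff T R ≠ 0 → T.IsSymm ∧ (T.map (Rat.cast : ℚ → ℝ)).PosSemidef ∧
    (((4 * m : ℚ) • T - Matrix.vecMulVec R R).map (Rat.cast : ℚ → ℝ)).PosSemidef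
  hasSum : ∀ τ ∈ siegelH g, ∀ z : Fin g → ℂ,
    HasSum (fun TR : Matrix (Fin g) (Fin g) ℚ × (Fin g → ℚ) =>
      ι (coeff TR.1 TR.2 : Qpur p) *
        e ((TR.1.map (Rat.cast : ℚ → ℂ) * τ).trace + ∑ i, z i * (TR.2 i : ℂ))) (toFun (τ, z))

namespace JacobiForm

variable {p : ℕ} [Fact p.Prime] {ι : Qpur p →+* ℂ} {g k m : ℕ}

/-- `φ ≡ 0 (mod 𝔭)`: all Fourier coefficients of `φ` lie in `𝔭`. -/
def IsZeroMod (φ : JacobiForm p ι g k m) : Prop :=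
  ∀ T R, φ.coeff T R ∈ primeP p

/-- The mod `𝔭` diagonal vanishing order of `φ`: the largest integer `l ≥ 0` such that
`c(T, R) ≡ 0 (mod 𝔭)` for all `R` and all `T` whose diagonal entries are all at most `l`.
For `φ ≢ 0 (mod 𝔭)` this is a natural number, equal to `0` if there is no such `l`;
for `φ ≡ 0 (mod 𝔭)` it is `∞`. -/
def diagOrd (φ : JacobiForm p ι g k m) : ℕ∞ :=
  ⨆ (l : ℕ) (_ : ∀ (T : Matrix (Fin g) (Fin g) ℚ) (R : Fin g → ℚ),
    (∀ i, T i i ≤ l) → φ.coeff T R ∈ primeP p), (l : ℕ∞)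

end JacobiForm

end SturmSlope

end

/-!
The proof specializes a Jacobi form `φ` to torsion points and transfers the slope bound from
Siegel modular forms for the full symplectic group to these specializations.

*Specialization.* For `λ, μ` in `(1/N) ℤ^g`, with `N` prime to `p`, the function
`e(m (λ τ λᵗ + λ μᵗ)) φ(τ, λ τ + μ)` transforms under the symplectic group like a modular form of weight `k`,
except that `(λ, μ)` is replaced by `(λ, μ) M` (`torsionFun_moebius`). It depends on `(λ, μ)`
modulo `ℤ^g` only up to roots of unity (`torsionFun_add_int`), so these functions, times all roots
of unity of order dividing `N²`, form a finite family `F` permuted by the symplectic group. Its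
Fourier coefficients lie in `O_𝔭`, since `ℚ_p^ur` contains the roots of unity of order prime to
`p` (`exists_rootOfUnity`). The Fourier coefficients of `φ` depend only on `4 m T - R Rᵗ` and on
`R` modulo `2 m`, and `R` can be chosen with `|R_i| ≤ m`; hence the order of each specialization
is at least that of `φ` minus `m / 4` (`coeff_torsionSeries_mem`).

*Transfer of the slope bound.* The diagonal vanishing order is not superadditive for products, so
that the product over `F` is of no use. Sums of Frobenius powers take its place: in characteristic
`p` the order of `f ^ q`, for `q = p ^ u`, is at least `q` times that of `f`
(`pow_mem_span_range_pow`). The power sum of `F` of degree `q + j` is a form of weight `k (q + j)`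
for the full symplectic group, and modulo `𝔭` its order is at least `q` times the minimal order in
`F`. For `q` large compared to `j` it therefore vanishes modulo `𝔭`, and a Vandermonde
determinant, applied to the distinct members of the reduction of `F`, shows that these vanish if
their multiplicities are prime to `p`. In general let `p ^ a` be the largest power of `p` dividing
all multiplicities of nonzero members. The elementary symmetric functions of `F` of degree
`p ^ a * j` reduce to those of the family of all `f ^ (p ^ a)` with the multiplicities divided by `p ^ a`
(`exists_divided_multiplicities`). By Newton's identities its power sums again lift to modular
forms (`exists_lift_power_sum`), and the argument applies to them (`map_eq_zero_of_esymm_mem`).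

*Conclusion.* The specializations to `z = μ` determine, for each `T`, the sums of `c(T, R)` over
the residue classes of `R` modulo `N`. If `N` is large, only one term is nonzero, so all `c(T, R)`
lie in `𝔭` (`coeff_mem_of_torsionSeries`).

Expansions of modular forms are handled as formal power series: a matrix `T` is encoded by the
values of a multiple of its quadratic form at the vectors `e_i + e_j` (`expMatrix`), which are
natural numbers.
-/

noncomputable section

namespace SturmSlope

/-! ### Roots of unity of order prime to `p` in `ℚ_p^ur` -/

section Unramified

open Polynomial

variable {A K L : Type*} [CommRing A] [IsDomain A] [IsIntegrallyClosed A] [Field K] [Algebra A K]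
  [IsFractionRing A K] [Field L] [Algebra K L] [Algebra A L] [IsScalarTower A K L]
  [FiniteDimensional K L] [Algebra.IsSeparable K L]

/-- The discriminant of the powers of a root of unity of order `Q`, with `Q` invertible in `A`,
is a unit of `A`: up to sign it is the norm of `f'(x)`, where `f` is the minimal polynomial of `x`,
and `f'(x)` divides the derivative `Q x^(Q-1)` of `X^Q - 1` at `x`. -/
theorem exists_discr_mul_eq_one {Q : ℕ} (hQ0 : Q ≠ 0) (hQ : IsUnit (Q : A)) (pb : PowerBasis K L)
    (hx : pb.gen ^ Q = 1) : ∃ w : A, algebraMap A K w * Algebra.discr K pb.basis = 1 := by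
  have hint : IsIntegral A pb.gen := IsIntegral.of_pow (Nat.pos_of_ne_zero hQ0)
    (by rw [hx]; exact isIntegral_one)
  have : FaithfulSMul A L := by
    rw [faithfulSMul_iff_algebraMap_injective, IsScalarTower.algebraMap_eq A K L]
    exact (algebraMap K L).injective.comp (IsFractionRing.injective A K)
  have : Module.IsTorsionFree A L := inferInstance
  obtain ⟨h, hh⟩ := minpoly.isIntegrallyClosed_dvd hint (p := X ^ Q - 1) (by simp [hx])
  have hder := congrArg (fun P => aeval pb.gen (derivative P)) hh
  simp only [derivative_mul, derivative_X_pow, derivative_one, map_sub, map_mul,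
    map_add, minpoly.aeval, zero_mul, add_zero, sub_zero, map_pow, aeval_X, map_natCast] at hder
  have hder' : (Q : L) = aeval pb.gen (derivative (minpoly A pb.gen)) *
      (aeval pb.gen h * pb.gen) := by
    rw [← mul_assoc, ← hder, mul_assoc, ← pow_succ, Nat.sub_add_cancel (Nat.pos_of_ne_zero hQ0),
      hx, mul_one]
  have hhint : IsIntegral A (aeval pb.gen h * pb.gen) := by
    refine IsIntegral.mul ?_ hint
    exact IsIntegral.of_mem_of_fg (Algebra.adjoin A {pb.gen}) hint.fg_adjoin_singleton _
      (aeval_mem_adjoin_singleton _ _)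
  obtain ⟨c, hc⟩ := IsIntegrallyClosed.isIntegral_iff.mp (Algebra.isIntegral_norm K hhint)
  have hnorm := congrArg (Algebra.norm K) hder'
  rw [map_mul, ← hc] at hnorm
  have hQn : Algebra.norm K (Q : L) = (Q : K) ^ Module.finrank K L := by
    rw [← map_natCast (algebraMap K L), Algebra.norm_algebraMap]
  have hmp : aeval pb.gen (derivative (minpoly A pb.gen)) =
      aeval pb.gen (derivative (minpoly K pb.gen)) := by
    rw [minpoly.isIntegrallyClosed_eq_field_fractions' K hint, derivative_map,
      aeval_map_algebraMap]
  rw [hQn, hmp] at hnorm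
  obtain ⟨u, hu⟩ := hQ.exists_left_inv
  have hu' : algebraMap A K u * (Q : K) = 1 := by
    rw [← map_natCast (algebraMap A K), ← map_mul, hu, map_one]
  refine ⟨(-1) ^ (Module.finrank K L * (Module.finrank K L - 1) / 2) * c *
    u ^ Module.finrank K L, ?_⟩
  rw [Algebra.discr_powerBasis_eq_norm]
  set s := (-1 : K) ^ (Module.finrank K L * (Module.finrank K L - 1) / 2) with hs
  have hs2 : s * s = 1 := by rw [hs, ← mul_pow]; simp
  simp only [map_mul, map_pow, map_neg, map_one]
  rw [← hs]
  calc _ = (s * s) * (algebraMap A K u ^ Module.finrank K L *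
        (Algebra.norm K (aeval pb.gen (derivative (minpoly K pb.gen))) * algebraMap A K c)) := by
        ring
    _ = 1 := by rw [hs2, ← hnorm, ← mul_pow, hu']; simp

/-- Adjoining a root of unity of order invertible in `A` is an unramified extension: the ring of
integers is generated by the root of unity `x`, and `Q x^(Q-1) dx = 0` forces `dx = 0`. -/
theorem formallyUnramified_integralClosure_of_pow_eq_one {Q : ℕ} (hQ0 : Q ≠ 0)
    (hQ : IsUnit (Q : A)) (pb : PowerBasis K L) (hx : pb.gen ^ Q = 1) :
    Algebra.FormallyUnramified A (integralClosure A L) := by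
  have hint : IsIntegral A pb.gen := IsIntegral.of_pow (Nat.pos_of_ne_zero hQ0)
    (by rw [hx]; exact isIntegral_one)
  obtain ⟨w, hw⟩ := exists_discr_mul_eq_one hQ0 hQ pb hx
  let x : integralClosure A L := ⟨pb.gen, hint⟩
  have hadj (b : integralClosure A L) : b ∈ Algebra.adjoin A {x} := by
    have h1 := Algebra.discr_mul_isIntegral_mem_adjoin K hint b.2
    have h2 : (b : L) ∈ Algebra.adjoin A {pb.gen} := by
      have h3 := Subalgebra.smul_mem _ h1 w
      rwa [algebra_compatible_smul K w, smul_smul, hw, one_smul] at h3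
    have h4 := AlgHom.map_adjoin_singleton (integralClosure A L).val x
    change _ = Algebra.adjoin A {pb.gen} at h4
    rw [← h4] at h2
    obtain ⟨c, hc, hcb⟩ := h2
    have : c = b := Subtype.ext hcb
    exact this ▸ hc
  have hxQ : x ^ Q = 1 := Subtype.ext (by simpa [x] using hx)
  let D := KaehlerDifferential.D A (integralClosure A L)
  have hDx : D x = 0 := by
    have h1 : D (x ^ Q) = 0 := by rw [hxQ]; exact D.map_one_eq_zero
    rw [D.leibniz_pow] at h1
    obtain ⟨u, hu⟩ := hQ.exists_left_inv
    have h2 : (u : A) • x • (Q • x ^ (Q - 1) • D x) = 0 := by rw [h1]; simp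
    rw [← Nat.cast_smul_eq_nsmul A Q, smul_comm x (Q : A), smul_smul, hu, one_smul, smul_smul,
      ← pow_succ', Nat.sub_add_cancel (Nat.pos_of_ne_zero hQ0), hxQ, one_smul] at h2
    exact h2
  have hD0 (b : integralClosure A L) : D b = 0 := by
    have h := Derivation.eqOn_adjoin (D1 := D) (D2 := 0) (s := {x})
      (by intro y hy; rw [Set.mem_singleton_iff.mp hy, hDx]; rfl) (hadj b)
    simpa using h
  constructor
  rw [← Submodule.subsingleton_iff (integralClosure A L), ← subsingleton_iff_bot_eq_top, eq_comm,
    ← KaehlerDifferential.span_range_derivation, Submodule.span_eq_bot]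
  rintro _ ⟨b, rfl⟩
  exact hD0 b

end Unramified

variable {p : ℕ} [Fact p.Prime]

theorem mem_Qpur_of_pow_eq_one {Q : ℕ} (hQ : p.Coprime Q) {x : PadicAlgCl p} (hx : x ^ Q = 1) :
    x ∈ Qpur p := by
  have hQ0 : Q ≠ 0 := by
    rintro rfl
    exact (Fact.out : p.Prime).one_lt.ne' ((Nat.coprime_zero_right p).mp hQ)
  have hint : IsIntegral ℚ_[p] x := Algebra.IsIntegral.isIntegral x
  let K := IntermediateField.adjoin ℚ_[p] {x}
  have hfin : FiniteDimensional ℚ_[p] K := IntermediateField.adjoin.finiteDimensional hint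
  have hle : K ≤ Qpur p := by
    refine le_iSup₂_of_le (f := fun (K : IntermediateField ℚ_[p] (PadicAlgCl p))
      (_ : FiniteDimensional ℚ_[p] K ∧ IsUnramifiedExt p K) => K) K ⟨hfin, ?_⟩ le_rfl
    refine formallyUnramified_integralClosure_of_pow_eq_one (K := ℚ_[p]) hQ0 ?_
      (IntermediateField.adjoin.powerBasis hint) ?_
    · rw [PadicInt.isUnit_iff, PadicInt.norm_natCast_eq_one_iff]
      exact hQ
    · rw [IntermediateField.adjoin.powerBasis_gen]
      exact Subtype.ext (by simpa using hx)
  exact hle (IntermediateField.mem_adjoin_simple_self _ x)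

/-- For `Q` prime to `p` the ring `O_𝔭` contains the preimage of `e(1/Q)`. -/
theorem exists_rootOfUnity (ι : Qpur p →+* ℂ) {Q : ℕ} (hQ : p.Coprime Q) :
    ∃ ζ : Op p, IsPrimitiveRoot ζ Q ∧ ι (ζ : Qpur p) = e ((1 : ℂ) / Q) := by
  have hQ0 : Q ≠ 0 := by
    rintro rfl
    exact (Fact.out : p.Prime).one_lt.ne' ((Nat.coprime_zero_right p).mp hQ)
  have : NeZero Q := ⟨hQ0⟩
  have : NeZero (Q : PadicAlgCl p) := ⟨by exact_mod_cast hQ0⟩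
  obtain ⟨x, hx⟩ := HasEnoughRootsOfUnity.exists_primitiveRoot (PadicAlgCl p) Q
  let y : Qpur p := ⟨x, mem_Qpur_of_pow_eq_one hQ hx.pow_eq_one⟩
  have hy : IsPrimitiveRoot y Q := hx.of_map_of_injective (f := algebraMap (Qpur p) (PadicAlgCl p))
    (algebraMap (Qpur p) (PadicAlgCl p)).injective
  have hιy : IsPrimitiveRoot (ι y) Q := hy.map_of_injective ι.injective
  have hexp : IsPrimitiveRoot (e ((1 : ℂ) / Q)) Q := by
    have := Complex.isPrimitiveRoot_exp Q hQ0
    rwa [show 2 * Real.pi * Complex.I / Q = 2 * Real.pi * Complex.I * ((1 : ℂ) / Q) by ring]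
      at this
  obtain ⟨i, -, hi⟩ := hιy.eq_pow_of_pow_eq_one hexp.pow_eq_one
  have hyi : IsPrimitiveRoot (y ^ i) Q := by
    refine IsPrimitiveRoot.of_map_of_injective (f := ι) ?_ ι.injective
    rw [map_pow, hi]
    exact hexp
  have hmem : y ^ i ∈ Op p := by
    have hv : Valued.v (algebraMap (Qpur p) (PadicAlgCl p) (y ^ i)) ^ Q = 1 := by
      rw [← map_pow, ← map_pow, hyi.pow_eq_one, map_one, map_one]
    have hv1 := (pow_eq_one_iff_of_nonneg zero_le hQ0).mp hv
    change Valued.v (algebraMap (Qpur p) (PadicAlgCl p) (y ^ i)) ≤ 1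
    exact hv1.le
  refine ⟨⟨y ^ i, hmem⟩, ?_, by simpa using hi⟩
  exact IsPrimitiveRoot.of_map_of_injective (f := (Op p).subtype) hyi Subtype.val_injective

/-! ### Power sums with divided multiplicities in characteristic `p` -/

section PowerSums

open Finset Polynomial

theorem coeff_prod_one_add_C_mul_X {D I : Type*} [CommRing D] (s : Finset I) (f : I → D) (j : ℕ) :
    (∏ i ∈ s, (1 + C (f i) * X)).coeff j = ∑ t ∈ s.powersetCard j, ∏ i ∈ t, f i := by
  classical
  rw [prod_one_add, finsetSum_coeff, powersetCard_eq_filter, sum_filter]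
  refine sum_congr rfl fun t _ => ?_
  rw [prod_mul_distrib, prod_const, ← map_prod, coeff_C_mul, coeff_X_pow]
  simp [eq_comm]

variable {D : Type*} [CommRing D]

/-- In characteristic `p`, raising to a power `q = p ^ u` maps the ideal generated by the `x i ^ L`
into the ideal generated by the `x i ^ (L * q)`. -/
theorem pow_mem_span_range_pow {κ : Type*} [Finite κ] (p : ℕ) [ExpChar D p] (x : κ → D) (L u : ℕ)
    {f : D} (hf : f ∈ Ideal.span (Set.range fun i => x i ^ L)) :
    f ^ p ^ u ∈ Ideal.span (Set.range fun i => x i ^ (L * p ^ u)) := by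
  have := Fintype.ofFinite κ
  rw [Ideal.mem_span_range_iff_exists_fun] at hf ⊢
  obtain ⟨c, rfl⟩ := hf
  refine ⟨fun i => c i ^ p ^ u, ?_⟩
  rw [sum_pow_char_pow]
  exact sum_congr rfl fun i _ => by rw [mul_pow, ← pow_mul]

/-- Let `f` be a finite family with the distinct nonzero values `s ∈ S`, taken with
multiplicities `n s = p ^ a * n' s`. Then `∏ (1 + f i X) = ∏ (1 + s ^ (p ^ a) X ^ (p ^ a)) ^ n' s`,
so the elementary symmetric functions of the multiset with `n' s` copies of `s ^ (p ^ a)` are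
elementary symmetric functions of `f`. Choosing `a` maximal makes some `n' s` prime to `p`. -/
theorem exists_divided_multiplicities {I : Type*} [Fintype I] (p : ℕ) [Fact p.Prime] [CharP D p]
    (f : I → D) (hf : ∃ i, f i ≠ 0) :
    ∃ (a : ℕ) (S : Finset D) (n : D → ℕ), (∀ s ∈ S, ∃ i, f i = s ∧ s ≠ 0) ∧
      (∃ s ∈ S, ¬ p ∣ n s) ∧
      ∀ j, ∑ t ∈ (univ : Finset (Σ s : S, Fin (n s))).powersetCard j, ∏ x ∈ t, (x.1 : D) ^ p ^ a =
        ∑ t ∈ (univ : Finset I).powersetCard (p ^ a * j), ∏ i ∈ t, f i := by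
  classical
  have hp : p.Prime := Fact.out
  let S : Finset D := (univ.image f).erase 0
  let N : D → ℕ := fun s => #{i | f i = s}
  have hSne : S.Nonempty := by
    obtain ⟨i, hi⟩ := hf
    exact ⟨f i, mem_erase.mpr ⟨hi, mem_image_of_mem _ (mem_univ i)⟩⟩
  have hS : ∀ s ∈ S, ∃ i, f i = s ∧ s ≠ 0 := fun s hs => by
    obtain ⟨h0, h1⟩ := mem_erase.mp hs
    obtain ⟨i, -, hi⟩ := mem_image.mp h1
    exact ⟨i, hi, h0⟩
  have hN : ∀ s ∈ S, N s ≠ 0 := fun s hs => by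
    obtain ⟨i, hi, -⟩ := hS s hs
    exact (card_pos.mpr ⟨i, by simp [hi]⟩).ne'
  obtain ⟨s₀, hs₀, hmin⟩ := exists_min_image S (fun s => padicValNat p (N s)) hSne
  let a := padicValNat p (N s₀)
  have hdvd : ∀ s ∈ S, p ^ a ∣ N s := fun s hs =>
    (pow_dvd_pow p (hmin s hs)).trans pow_padicValNat_dvd
  let n : D → ℕ := fun s => N s / p ^ a
  have hn : ∀ s ∈ S, N s = p ^ a * n s := fun s hs => (Nat.mul_div_cancel' (hdvd s hs)).symm
  refine ⟨a, S, n, hS, ⟨s₀, hs₀, fun hd => ?_⟩, fun j => ?_⟩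
  · refine pow_succ_padicValNat_not_dvd (p := p) (hN s₀ hs₀) ?_
    rw [pow_succ, show N s₀ = p ^ padicValNat p (N s₀) * n s₀ from hn s₀ hs₀]
    have h := mul_dvd_mul_left (p ^ a) hd
    rwa [← hn s₀ hs₀] at h ⊢
  · rw [← coeff_prod_one_add_C_mul_X, ← coeff_prod_one_add_C_mul_X]
    have hexp : ∏ i : I, (1 + C (f i) * X) =
        expand D (p ^ a) (∏ x : (Σ s : S, Fin (n s)), (1 + C ((x.1 : D) ^ p ^ a) * X)) := by
      rw [Fintype.prod_sigma, map_prod]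
      simp only [prod_const, card_univ, Fintype.card_fin, map_pow, map_add, map_one, map_mul,
        expand_C, expand_X]
      have h1 (s : D) : (1 + C s ^ p ^ a * (X : D[X]) ^ p ^ a) = (1 + C s * X) ^ p ^ a := by
        rw [add_pow_char_pow, one_pow, mul_pow]
      simp only [h1]
      rw [prod_coe_sort S (fun s => (((1 : D[X]) + C s * X) ^ p ^ a) ^ n s)]
      have h2 : ∏ s ∈ S, (((1 : D[X]) + C s * X) ^ p ^ a) ^ n s =
          ∏ s ∈ univ.image f, ((1 : D[X]) + C s * X) ^ N s := by
        rw [prod_congr rfl fun s hs => by rw [← pow_mul, ← hn s hs]]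
        exact prod_erase _ (by simp)
      rw [h2, prod_comp (fun s => (1 : D[X]) + C s * X) f]
    rw [hexp, mul_comm (p ^ a) j, coeff_expand_mul (pow_pos hp.pos a)]

/-- Newton's identities: the power sums of a finite family whose elementary symmetric functions
lift to homogeneous elements of degree `d * j` lift to homogeneous elements of degree `d * t`. -/
theorem exists_lift_power_sum {O J : Type*} [CommRing O] [Fintype J] (M : ℕ → AddSubgroup O)
    [SetLike.GradedMonoid M] (π : O →+* D) (d : ℕ) (g : J → D)
    (hE : ∀ j, ∃ e ∈ M (d * j), π e = ∑ t ∈ (univ : Finset J).powersetCard j, ∏ x ∈ t, g x)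
    (t : ℕ) (ht : 0 < t) : ∃ h ∈ M (d * t), π h = ∑ x, g x ^ t := by
  choose e he hπe using hE
  induction t using Nat.strong_induction_on with
  | _ t ih =>
    have hP : ∀ n, MvPolynomial.aeval g (MvPolynomial.psum J ℤ n) = ∑ x, g x ^ n := fun n => by
      simp [MvPolynomial.psum]
    have hES : ∀ n, MvPolynomial.aeval g (MvPolynomial.esymm J ℤ n) = π (e n) := fun n => by
      rw [hπe]; simp [MvPolynomial.esymm]
    have hnewton := congrArg (MvPolynomial.aeval g) (MvPolynomial.psum_eq_mul_esymm_sub_sum J ℤ t ht)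
    simp only [map_sub, map_mul, map_pow, map_neg, map_one, map_natCast, map_sum, hP, hES]
      at hnewton
    let H : ℕ × ℕ → O := fun b =>
      if h : b.2 < t ∧ 0 < b.2 then (ih b.2 h.1 h.2).choose else 0
    have hH : ∀ b : ℕ × ℕ, b.2 < t → 0 < b.2 → H b ∈ M (d * b.2) ∧ π (H b) = ∑ x, g x ^ b.2 :=
      fun b h1 h2 => by
        simp only [H, dif_pos (And.intro h1 h2)]
        exact (ih b.2 h1 h2).choose_spec
    have hb : ∀ b ∈ (antidiagonal t).filter (fun b => b.1 ∈ Set.Ioo 0 t),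
        b.1 + b.2 = t ∧ b.2 < t ∧ 0 < b.2 := fun b hb => by
      obtain ⟨h1, h2, h3⟩ := mem_filter.mp hb
      have := mem_antidiagonal.mp h1
      omega
    have hneg : ∀ (n w : ℕ) (y : O), y ∈ M w → (-1) ^ n * y ∈ M w := fun n w y hy => by
      rcases neg_one_pow_eq_or O n with h | h <;> simp [h, hy]
    refine ⟨(-1) ^ (t + 1) * (t * e t) - ∑ b ∈ antidiagonal t with b.1 ∈ Set.Ioo 0 t,
      (-1) ^ b.1 * (e b.1 * H b), ?_, ?_⟩
    · refine sub_mem (hneg _ _ _ ?_) (sum_mem fun b hbm => hneg _ _ _ ?_)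
      · rw [← nsmul_eq_mul]
        exact nsmul_mem (he t) t
      · obtain ⟨h1, h2, h3⟩ := hb b hbm
        have := SetLike.GradedMul.mul_mem (he b.1) (hH b h2 h3).1
        rwa [← mul_add, h1] at this
    · simp only [map_sub, map_mul, map_pow, map_neg, map_one, map_natCast, map_sum]
      rw [hnewton, ← mul_assoc]
      congr 1
      refine sum_congr rfl fun b hbm => ?_
      obtain ⟨h1, h2, h3⟩ := hb b hbm
      rw [(hH b h2 h3).2, mul_assoc]

/-- Let `M` be a graded ring of "forms" with reduction `π`, and `F` a finite family whose
elementary symmetric functions of degree `j` are forms of weight `k * j`. If all reductions `π (F i)`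
lie in the ideal generated by the `x i ^ L`, and forms of weight close to `p ^ a * q * k`, with
reduction in the ideal generated by the `x i ^ (L * (p ^ a * q))` for large `q = p ^ u`, reduce to
zero, then all `F i` reduce to zero. -/
theorem map_eq_zero_of_esymm_mem [IsDomain D] {O I κ : Type*} [CommRing O] [Fintype I] [Finite κ]
    (p : ℕ) [Fact p.Prime] [CharP D p] (M : ℕ → AddSubgroup O) [SetLike.GradedMonoid M]
    (π : O →+* D) (k L : ℕ) (x : κ → D) (F : I → O)
    (hE : ∀ j, ∑ t ∈ (univ : Finset I).powersetCard j, ∏ i ∈ t, F i ∈ M (k * j))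
    (hF : ∀ i, π (F i) ∈ Ideal.span (Set.range fun c => x c ^ L))
    (hslope : ∀ a r : ℕ, ∃ u : ℕ, ∀ j < r, ∀ h ∈ M (k * p ^ a * (p ^ u + j)),
      π h ∈ Ideal.span (Set.range fun c => x c ^ (L * (p ^ a * p ^ u))) → π h = 0)
    (i : I) : π (F i) = 0 := by
  classical
  have hp : p.Prime := Fact.out
  by_contra hi
  obtain ⟨a, S, n, hS, ⟨s₀, hs₀, hn₀⟩, hES⟩ :=
    exists_divided_multiplicities p (fun i => π (F i)) ⟨i, hi⟩
  obtain ⟨u, hu⟩ := hslope a #S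
  have hzero : ∀ j < #S, ∑ s ∈ S, (n s : D) * (s ^ (p ^ a * p ^ u) * (s ^ p ^ a) ^ j) = 0 := by
    intro j hj
    obtain ⟨h, hM, hh⟩ := exists_lift_power_sum M π (k * p ^ a)
      (fun x : (Σ s : S, Fin (n s)) => (x.1 : D) ^ p ^ a) (fun j =>
        ⟨∑ t ∈ (univ : Finset I).powersetCard (p ^ a * j), ∏ i ∈ t, F i,
          by rw [mul_assoc]; exact hE _, by rw [hES]; simp⟩)
      (p ^ u + j) (Nat.add_pos_left (pow_pos hp.pos u) j)
    have hsum : π h = ∑ s ∈ S, (n s : D) * (s ^ (p ^ a * p ^ u) * (s ^ p ^ a) ^ j) := by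
      rw [hh, Fintype.sum_sigma]
      simp only [sum_const, card_univ, Fintype.card_fin, nsmul_eq_mul]
      rw [sum_coe_sort S (fun s => (n s : D) * (s ^ p ^ a) ^ (p ^ u + j))]
      exact sum_congr rfl fun s _ => by rw [pow_add, ← pow_mul s]
    rw [← hsum]
    refine hu j hj h hM ?_
    rw [hsum]
    refine sum_mem fun s hs => Ideal.mul_mem_left _ _ (Ideal.mul_mem_right _ _ ?_)
    obtain ⟨i, rfl, -⟩ := hS s hs
    rw [← pow_add]
    exact pow_mem_span_range_pow p x L (a + u) (hF i)
  -- The `s ^ (p ^ a)` are distinct, so that a Vandermonde determinant is nonzero.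
  let eS := S.equivFin.symm
  have hvan := Matrix.eq_zero_of_forall_pow_sum_mul_pow_eq_zero (R := D)
    (f := fun c : Fin #S => (eS c : D) ^ p ^ a)
    (v := fun c => (n (eS c) : D) * (eS c : D) ^ (p ^ a * p ^ u))
    (fun c c' h => eS.injective (Subtype.ext (iterateFrobenius_inj D p a h))) (fun j => by
      rw [← hzero j j.2, ← sum_coe_sort S, ← eS.sum_comp]
      exact sum_congr rfl fun c _ => mul_assoc _ _ _)
  have h0 := congrFun hvan (eS.symm ⟨s₀, hs₀⟩)
  simp only [Equiv.apply_symm_apply, Pi.zero_apply, mul_eq_zero] at h0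
  obtain ⟨i₀, -, hne⟩ := hS s₀ hs₀
  rcases h0 with h0 | h0
  · exact hn₀ ((CharP.cast_eq_zero_iff D p _).mp h0)
  · exact hne (eq_zero_of_pow_eq_zero h0)

end PowerSums

/-! ### Uniqueness of Fourier expansions -/

section Fourier

open Filter Topology Matrix

theorem e_add (x y : ℂ) : e (x + y) = e x * e y := by
  rw [e, e, e, mul_add, Complex.exp_add]

@[simp] theorem e_zero : e 0 = 1 := by simp [e]

theorem e_ne_zero (x : ℂ) : e x ≠ 0 := Complex.exp_ne_zero _

theorem e_natCast_mul (n : ℕ) (x : ℂ) : e (n * x) = e x ^ n := by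
  rw [e, e, ← Complex.exp_nat_mul]; congr 1; ring

theorem e_intCast_mul (n : ℤ) (x : ℂ) : e (n * x) = e x ^ n := by
  rw [e, e, ← Complex.exp_int_mul]; congr 1; ring

theorem e_neg (x : ℂ) : e (-x) = (e x)⁻¹ := by
  rw [e, e, ← Complex.exp_neg]; congr 1; ring

theorem norm_e_ofReal (x : ℝ) : ‖e x‖ = 1 := by
  rw [e, show 2 * Real.pi * Complex.I * (x : ℂ) = ((2 * Real.pi * x : ℝ) : ℂ) * Complex.I by
    push_cast; ring]
  exact Complex.norm_exp_ofReal_mul_I _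

theorem e_eq_one_iff {x : ℂ} : e x = 1 ↔ ∃ n : ℤ, x = n := by
  rw [e, Complex.exp_eq_one_iff]
  have h : (2 * Real.pi * Complex.I : ℂ) ≠ 0 := Complex.two_pi_I_ne_zero
  refine exists_congr fun n => ⟨fun h1 => ?_, fun h1 => by rw [h1]; ring⟩
  refine mul_left_cancel₀ h ?_
  rw [h1]; ring

theorem e_intCast (n : ℤ) : e n = 1 := e_eq_one_iff.mpr ⟨n, rfl⟩

/-- The averages of the powers of `z ≠ 1` on the unit circle tend to zero. -/
theorem tendsto_average_pow {z : ℂ} (hz : ‖z‖ = 1) (hz1 : z ≠ 1) :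
    Tendsto (fun n : ℕ => (n : ℂ)⁻¹ * ∑ j ∈ Finset.range n, z ^ j) atTop (𝓝 0) := by
  have hbd : ∀ n : ℕ, ‖(n : ℂ)⁻¹ * ∑ j ∈ Finset.range n, z ^ j‖ ≤ (n : ℝ)⁻¹ * (2 / ‖z - 1‖) := by
    intro n
    rw [norm_mul, norm_inv, Complex.norm_natCast, geom_sum_eq hz1, norm_div]
    gcongr
    calc ‖z ^ n - 1‖ ≤ ‖z ^ n‖ + ‖(1 : ℂ)‖ := norm_sub_le _ _
      _ = 2 := by rw [norm_pow, hz]; norm_num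
  refine squeeze_zero_norm hbd ?_
  simpa using (tendsto_inv_atTop_zero.comp tendsto_natCast_atTop_atTop).mul_const (2 / ‖z - 1‖)

/-- An absolutely convergent almost periodic series that vanishes at all natural numbers, with
frequencies distinct modulo `ℤ`, has vanishing coefficients: a coefficient is the mean value of
the series against the conjugate of its character. -/
theorem eq_zero_of_hasSum_e {α : Type*} (b : α → ℂ) (ω : α → ℝ)
    (hω : ∀ x y, b x ≠ 0 → b y ≠ 0 → (∃ n : ℤ, ω x - ω y = n) → x = y)
    (h : ∀ j : ℕ, HasSum (fun x => b x * e (j * ω x)) 0) (x₀ : α) : b x₀ = 0 := by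
  classical
  by_contra hx₀
  have hsum : Summable fun x => ‖b x‖ := by
    have := (h 0).summable.norm
    simpa using this
  let z : α → ℂ := fun x => e ((ω x - ω x₀ : ℝ) : ℂ)
  have hz : ∀ x, ‖z x‖ = 1 := fun x => norm_e_ofReal _
  have hzero : ∀ n : ℕ, HasSum (fun x => b x * ((n : ℂ)⁻¹ * ∑ j ∈ Finset.range n, z x ^ j)) 0 := by
    intro n
    have h1 : ∀ j ∈ Finset.range n, HasSum (fun x => (n : ℂ)⁻¹ * (b x * z x ^ j)) 0 := by
      intro j _
      have h2 := ((h j).mul_right (e (-(j * ω x₀)))).mul_left (n : ℂ)⁻¹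
      simp only [zero_mul, mul_zero] at h2
      refine h2.congr_fun fun x => ?_
      rw [mul_assoc, ← e_add, ← e_natCast_mul]
      congr 3
      push_cast
      ring
    have h3 := hasSum_sum h1
    rw [Finset.sum_const_zero] at h3
    refine h3.congr_fun fun x => ?_
    rw [Finset.mul_sum, Finset.mul_sum]
    exact Finset.sum_congr rfl fun j _ => by ring
  have hlim : Tendsto (fun n : ℕ => ∑' x, b x * ((n : ℂ)⁻¹ * ∑ j ∈ Finset.range n, z x ^ j)) atTop
      (𝓝 (∑' x, if x = x₀ then b x₀ else 0)) := by
    refine tendsto_tsum_of_dominated_convergence hsum (fun x => ?_) (.of_forall fun n x => ?_)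
    · by_cases hx : x = x₀
      · subst hx
        have hz1 : z x = 1 := by simp [z]
        simp only [hz1, one_pow, Finset.sum_const, Finset.card_range, if_true, nsmul_eq_mul,
          mul_one]
        refine tendsto_const_nhds.congr' ?_
        filter_upwards [eventually_ne_atTop 0] with n hn
        rw [inv_mul_cancel₀ (by exact_mod_cast hn), mul_one]
      · rw [if_neg hx]
        by_cases hb : b x = 0
        · simp [hb]
        · have hz1 : z x ≠ 1 := fun h1 => by
            obtain ⟨n, hn⟩ := e_eq_one_iff.mp h1
            exact hx (hω x x₀ hb hx₀ ⟨n, by exact_mod_cast hn⟩)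
          simpa using (tendsto_average_pow (hz x) hz1).const_mul (b x)
    · rw [norm_mul]
      refine mul_le_of_le_one_right (norm_nonneg _) ?_
      rw [norm_mul, norm_inv, Complex.norm_natCast]
      calc (n : ℝ)⁻¹ * ‖∑ j ∈ Finset.range n, z x ^ j‖ ≤ (n : ℝ)⁻¹ * n := by
            gcongr
            refine (norm_sum_le _ _).trans ?_
            simp [hz x]
        _ ≤ 1 := inv_mul_le_one
  rw [tsum_ite_eq] at hlim
  refine hx₀ (tendsto_nhds_unique hlim ?_)
  simp only [(hzero _).tsum_eq]
  exact tendsto_const_nhds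

/-- There are real numbers that are, together with `1`, linearly independent over `ℚ`. -/
theorem exists_real_linearIndependent (d : Type) [Fintype d] :
    ∃ α : d → ℝ, ∀ q : d → ℚ, (∃ n : ℤ, ∑ i, (q i : ℝ) * α i = n) → q = 0 := by
  let B := Module.Basis.ofVectorSpace ℚ ℝ
  have hinf : Infinite (Module.Basis.ofVectorSpaceIndex ℚ ℝ) := by
    rw [Cardinal.infinite_iff, B.mk_eq_rank'', Real.rank_rat_real]
    exact Cardinal.aleph0_le_continuum
  obtain ⟨φ⟩ : Nonempty (Option d ↪ Module.Basis.ofVectorSpaceIndex ℚ ℝ) := by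
    obtain ⟨s, hs⟩ := Infinite.exists_subset_card_eq (Module.Basis.ofVectorSpaceIndex ℚ ℝ)
      (Fintype.card (Option d))
    have e1 : Option d ≃ s := Fintype.equivOfCardEq (by simp [hs])
    exact ⟨e1.toEmbedding.trans (Function.Embedding.subtype _)⟩
  have hli : LinearIndependent ℚ (fun i : Option d => B (φ i)) :=
    B.linearIndependent.comp φ φ.injective
  have h0 : B (φ none) ≠ 0 := B.ne_zero _
  refine ⟨fun i => B (φ (some i)) / B (φ none), fun q ⟨n, hn⟩ => ?_⟩
  rw [Fintype.linearIndependent_iff] at hli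
  have h := hli (fun o => o.elim (-(n : ℚ)) q) (by
    rw [Fintype.sum_option]
    simp only [Option.elim, Rat.smul_def]
    have h1 : ∑ i, (q i : ℝ) * B (φ (some i)) = n * B (φ none) := by
      rw [← hn, Finset.sum_mul]
      exact Finset.sum_congr rfl fun i _ => by field_simp
    rw [h1]
    push_cast
    ring)
  funext i
  exact h (some i)

variable {g : ℕ}

theorem I_smul_one_mem_siegelH : (Complex.I • (1 : Matrix (Fin g) (Fin g) ℂ)) ∈ siegelH g := by
  refine ⟨by simp [Matrix.IsSymm], ?_⟩
  have : (Complex.I • (1 : Matrix (Fin g) (Fin g) ℂ)).map Complex.im = 1 := by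
    ext i j
    by_cases h : i = j <;> simp [h, Matrix.one_apply]
  rw [this]
  exact Matrix.PosDef.one

theorem add_real_mem_siegelH {τ : Matrix (Fin g) (Fin g) ℂ} (hτ : τ ∈ siegelH g)
    {S : Matrix (Fin g) (Fin g) ℝ} (hS : S.IsSymm) :
    τ + S.map (fun x : ℝ => (x : ℂ)) ∈ siegelH g := by
  refine ⟨hτ.1.add ?_, ?_⟩
  · rw [Matrix.IsSymm, ← Matrix.transpose_map, hS.eq]
  · have : (τ + S.map (fun x : ℝ => (x : ℂ))).map Complex.im = τ.map Complex.im := by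
      ext i j; simp
    rw [this]
    exact hτ.2

/-- The character `e(tr(Tτ) + zR)` in the Fourier expansion of a Jacobi form. -/
def jacobiChar (x : Matrix (Fin g) (Fin g) ℚ × (Fin g → ℚ)) (τ : Matrix (Fin g) (Fin g) ℂ)
    (z : Fin g → ℂ) : ℂ :=
  e ((x.1.map (Rat.cast : ℚ → ℂ) * τ).trace + ∑ i, z i * (x.2 i : ℂ))

theorem trace_map_mul (T : Matrix (Fin g) (Fin g) ℚ) (τ : Matrix (Fin g) (Fin g) ℂ) :
    (T.map (Rat.cast : ℚ → ℂ) * τ).trace = ∑ i, ∑ j, (T i j : ℂ) * τ j i := by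
  simp [Matrix.trace, Matrix.mul_apply]

theorem jacobiChar_add (x : Matrix (Fin g) (Fin g) ℚ × (Fin g → ℚ))
    (τ τ' : Matrix (Fin g) (Fin g) ℂ) (z z' : Fin g → ℂ) :
    jacobiChar x (τ + τ') (z + z') = jacobiChar x τ z * jacobiChar x τ' z' := by
  rw [jacobiChar, jacobiChar, jacobiChar, ← e_add, Matrix.mul_add, Matrix.trace_add]
  simp only [Pi.add_apply, add_mul, Finset.sum_add_distrib]
  congr 1
  ring

theorem jacobiChar_ne_zero (x : Matrix (Fin g) (Fin g) ℚ × (Fin g → ℚ))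
    (τ : Matrix (Fin g) (Fin g) ℂ) (z : Fin g → ℂ) : jacobiChar x τ z ≠ 0 := e_ne_zero _

/-- Uniqueness of Fourier expansions: the series is restricted to the real line through
`τ = i` and `z = 0` in a direction with rationally independent coordinates. -/
theorem eq_zero_of_hasSum_jacobiChar (a : Matrix (Fin g) (Fin g) ℚ × (Fin g → ℚ) → ℂ)
    (hsymm : ∀ x, a x ≠ 0 → x.1.IsSymm)
    (h : ∀ τ ∈ siegelH g, ∀ z, HasSum (fun x => a x * jacobiChar x τ z) 0)
    (x : Matrix (Fin g) (Fin g) ℚ × (Fin g → ℚ)) : a x = 0 := by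
  obtain ⟨α, hα⟩ := exists_real_linearIndependent ((Fin g × Fin g) ⊕ Fin g)
  let S : Matrix (Fin g) (Fin g) ℝ := .of fun i j => α (.inl (i, j)) + α (.inl (j, i))
  let v : Fin g → ℝ := fun i => α (.inr i)
  have hS : S.IsSymm := by
    ext i j
    exact add_comm _ _
  let τ₀ : Matrix (Fin g) (Fin g) ℂ := Complex.I • 1
  let ω : Matrix (Fin g) (Fin g) ℚ × (Fin g → ℚ) → ℝ := fun x =>
    (∑ i, ∑ j, (x.1 i j : ℝ) * S j i) + ∑ i, v i * (x.2 i : ℝ)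
  have hchar : ∀ (j : ℕ) x, jacobiChar x (τ₀ + ((j : ℝ) • S).map (fun x : ℝ => (x : ℂ)))
      (0 + fun i => (j : ℂ) * v i) = jacobiChar x τ₀ 0 * e (j * ω x) := by
    intro j x
    rw [jacobiChar_add]
    congr 1
    rw [jacobiChar, trace_map_mul]
    congr 1
    simp only [ω, Matrix.map_apply, Matrix.smul_apply, smul_eq_mul]
    push_cast
    rw [mul_add, Finset.mul_sum, Finset.mul_sum]
    simp only [Finset.mul_sum]
    congr 1
    · exact Finset.sum_congr rfl fun i _ => Finset.sum_congr rfl fun l _ => by ring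
    · exact Finset.sum_congr rfl fun i _ => by ring
  have key := eq_zero_of_hasSum_e (fun x => a x * jacobiChar x τ₀ 0) ω (fun x y hx hy hn => ?_)
    (fun j => by
      have h1 := h _ (add_real_mem_siegelH I_smul_one_mem_siegelH (S := (j : ℝ) • S)
        (hS.smul _)) (0 + fun i => (j : ℂ) * v i)
      refine h1.congr_fun fun x => ?_
      rw [hchar]
      ring) x
  · exact (mul_eq_zero.mp key).resolve_right (jacobiChar_ne_zero _ _ _)
  · have hxs := hsymm x (left_ne_zero_of_mul hx)
    have hys := hsymm y (left_ne_zero_of_mul hy)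
    obtain ⟨n, hn⟩ := hn
    have hω : ∀ x : Matrix (Fin g) (Fin g) ℚ × (Fin g → ℚ), x.1.IsSymm →
        ω x = ∑ i, ∑ j, 2 * (x.1 i j : ℝ) * α (.inl (i, j)) + ∑ i, (x.2 i : ℝ) * α (.inr i) := by
      intro x hx
      have h1 : ∑ i, ∑ j, (x.1 i j : ℝ) * α (.inl (j, i)) =
          ∑ i, ∑ j, (x.1 i j : ℝ) * α (.inl (i, j)) := by
        rw [Finset.sum_comm]
        exact Finset.sum_congr rfl fun i _ => Finset.sum_congr rfl fun j _ => by
          rw [hx.apply]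
      simp only [ω, S, v, Matrix.of_apply, mul_add, Finset.sum_add_distrib, h1, mul_assoc,
        ← Finset.mul_sum]
      rw [two_mul]
      congr 1
      exact Finset.sum_congr rfl fun i _ => mul_comm _ _
    have h0 := hα (Sum.elim (fun ij => 2 * (x.1 ij.1 ij.2 - y.1 ij.1 ij.2))
      (fun i => x.2 i - y.2 i)) ⟨n, by
        rw [← hn, hω x hxs, hω y hys, Fintype.sum_sum_type, Fintype.sum_prod_type]
        simp only [Sum.elim_inl, Sum.elim_inr]
        push_cast
        rw [add_sub_add_comm, ← Finset.sum_sub_distrib, ← Finset.sum_sub_distrib]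
        simp only [← Finset.sum_sub_distrib]
        congr 1
        · exact Finset.sum_congr rfl fun i _ => Finset.sum_congr rfl fun l _ => by ring
        · exact Finset.sum_congr rfl fun i _ => by ring⟩
    refine Prod.ext ?_ ?_
    · ext i j
      have := congrFun h0 (.inl (i, j))
      simp only [Sum.elim_inl, Pi.zero_apply] at this
      linarith
    · funext i
      have := congrFun h0 (.inr i)
      simp only [Sum.elim_inr, Pi.zero_apply] at this
      linarith

end Fourier

/-! ### Integrality and symmetry of the Fourier coefficients of Jacobi forms -/

section JacobiCoeff

open Matrix

variable {g : ℕ}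

/-- Translation `R ↦ R + 2 m λ` of the Fourier indices of Jacobi forms of index `m`; it leaves
`4 m T - R Rᵗ` unchanged. -/
def indexShift (m : ℕ) (lam : Fin g → ℚ) :
    Matrix (Fin g) (Fin g) ℚ × (Fin g → ℚ) → Matrix (Fin g) (Fin g) ℚ × (Fin g → ℚ) := fun x =>
  (x.1 + (2⁻¹ : ℚ) • (vecMulVec lam x.2 + vecMulVec x.2 lam) + (m : ℚ) • vecMulVec lam lam,
    x.2 + (2 * m : ℚ) • lam)

theorem indexShift_fst_apply (m : ℕ) (lam : Fin g → ℚ) (x) (i j : Fin g) :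
    (indexShift m lam x).1 i j =
      x.1 i j + (lam i * x.2 j + x.2 i * lam j) / 2 + m * (lam i * lam j) := by
  simp [indexShift, vecMulVec_apply]; ring

theorem indexShift_snd_apply (m : ℕ) (lam : Fin g → ℚ) (x) (i : Fin g) :
    (indexShift m lam x).2 i = x.2 i + 2 * m * lam i := by
  simp [indexShift]

theorem indexShift_neg_indexShift (m : ℕ) (lam : Fin g → ℚ) (x) :
    indexShift m (-lam) (indexShift m lam x) = x := by
  refine Prod.ext (Matrix.ext fun i j => ?_) (funext fun i => ?_)
  · simp only [indexShift_fst_apply, indexShift_snd_apply, Pi.neg_apply]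
    ring
  · simp only [indexShift_snd_apply, Pi.neg_apply]
    ring

/-- `indexShift` as a permutation of the set of indices. -/
def indexShiftEquiv (m : ℕ) (lam : Fin g → ℚ) :
    Equiv.Perm (Matrix (Fin g) (Fin g) ℚ × (Fin g → ℚ)) where
  toFun := indexShift m lam
  invFun := indexShift m (-lam)
  left_inv := indexShift_neg_indexShift m lam
  right_inv x := by simpa using indexShift_neg_indexShift m (-lam) x

theorem indexShift_isSymm (m : ℕ) (lam : Fin g → ℚ) {x} (hx : x.1.IsSymm) :
    (indexShift m lam x).1.IsSymm := by
  ext i j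
  rw [Matrix.transpose_apply, indexShift_fst_apply, indexShift_fst_apply, hx.apply]
  ring

/-- Translating `z` by `λ τ` translates the Fourier index by `λ`. -/
theorem jacobiChar_indexShift (m : ℕ) (lam : Fin g → ℚ) (x) {τ : Matrix (Fin g) (Fin g) ℂ}
    (hτ : τ.IsSymm) (z : Fin g → ℂ) :
    jacobiChar (indexShift m lam x) τ z =
      e (m * (((fun i => (lam i : ℂ)) ᵥ* τ) ⬝ᵥ (fun i => (lam i : ℂ)) +
        2 * ((fun i => (lam i : ℂ)) ⬝ᵥ z))) *
      jacobiChar x τ (z + (fun i => (lam i : ℂ)) ᵥ* τ) := by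
  have hs : ∀ i j, τ j i = τ i j := fun i j => hτ.apply i j
  rw [jacobiChar, jacobiChar, ← e_add, trace_map_mul, trace_map_mul]
  congr 1
  simp only [indexShift_fst_apply, indexShift_snd_apply, dotProduct, vecMul, Pi.add_apply]
  push_cast
  have h1 : ∑ i, ∑ j, ((x.1 i j : ℂ) + ((lam i : ℂ) * x.2 j + x.2 i * lam j) / 2 +
      m * (lam i * lam j)) * τ j i = ∑ i, ∑ j, (x.1 i j : ℂ) * τ j i +
        ∑ i, ∑ j, (lam j : ℂ) * τ j i * x.2 i + m * ∑ i, ∑ j, (lam j : ℂ) * τ j i * lam i := by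
    have h2 : ∑ i, ∑ j, (lam i * x.2 j / 2 : ℂ) * τ j i =
        ∑ i, ∑ j, (lam j * x.2 i / 2 : ℂ) * τ j i := by
      rw [Finset.sum_comm]
      exact Finset.sum_congr rfl fun i _ => Finset.sum_congr rfl fun j _ => by rw [hs]
    have h3 : ∀ i j, ((x.1 i j : ℂ) + ((lam i : ℂ) * x.2 j + x.2 i * lam j) / 2 +
      m * (lam i * lam j)) * τ j i = (x.1 i j : ℂ) * τ j i + (lam i * x.2 j / 2 : ℂ) * τ j i +
        (lam j * x.2 i / 2 : ℂ) * τ j i + m * ((lam j : ℂ) * τ j i * lam i) := fun i j => by ring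
    simp only [h3, Finset.sum_add_distrib, h2, Finset.mul_sum]
    rw [add_assoc (∑ i, ∑ j, (x.1 i j : ℂ) * τ j i)]
    congr 2
    rw [← Finset.sum_add_distrib]
    refine Finset.sum_congr rfl fun i _ => ?_
    rw [← Finset.sum_add_distrib]
    exact Finset.sum_congr rfl fun j _ => by ring
  rw [h1]
  simp only [Finset.sum_mul, mul_add, add_mul, Finset.sum_add_distrib, Finset.mul_sum]
  have h4 : ∀ i, z i * (2 * m * lam i : ℂ) = m * (2 * (lam i * z i)) := fun i => by ring
  simp only [h4]
  ring

theorem denom_fromBlocks_one (S : Matrix (Fin g) (Fin g) ℤ) (τ : Matrix (Fin g) (Fin g) ℂ) :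
    denom (fromBlocks 1 S 0 1) τ = 1 := by
  simp [denom]

theorem moebius_fromBlocks_one (S : Matrix (Fin g) (Fin g) ℤ) (τ : Matrix (Fin g) (Fin g) ℂ) :
    moebius (fromBlocks 1 S 0 1) τ = τ + S.map (Int.cast : ℤ → ℂ) := by
  simp [moebius, denom_fromBlocks_one]

theorem fromBlocks_one_mem {S : Matrix (Fin g) (Fin g) ℤ} (hS : S.IsSymm) :
    fromBlocks 1 S 0 1 ∈ symplecticGroup (Fin g) ℤ := by
  rw [SymplecticGroup.fromBlocks_mem_iff]
  simp [hS.eq]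

namespace JacobiForm

variable {p : ℕ} [Fact p.Prime] {ι : Qpur p →+* ℂ} {k m : ℕ} (φ : JacobiForm p ι g k m)

theorem hasSum_jacobiChar {τ : Matrix (Fin g) (Fin g) ℂ} (hτ : τ ∈ siegelH g) (z : Fin g → ℂ) :
    HasSum (fun x => ι (φ.coeff x.1 x.2 : Qpur p) * jacobiChar x τ z) (φ.toFun (τ, z)) :=
  φ.hasSum τ hτ z

theorem isSymm_of_coeff_ne_zero {x : Matrix (Fin g) (Fin g) ℚ × (Fin g → ℚ)}
    (hx : ι (φ.coeff x.1 x.2 : Qpur p) ≠ 0) : x.1.IsSymm :=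
  (φ.coeff_supp x.1 x.2 fun h => hx (by simp [h])).1

theorem toFun_add_int {τ : Matrix (Fin g) (Fin g) ℂ} (hτ : τ ∈ siegelH g) (z : Fin g → ℂ)
    {S : Matrix (Fin g) (Fin g) ℤ} (hS : S.IsSymm) (mu : Fin g → ℤ) :
    φ.toFun (τ + S.map (Int.cast : ℤ → ℂ), z + fun i => (mu i : ℂ)) = φ.toFun (τ, z) := by
  rw [← φ.invariant _ (fromBlocks_one_mem hS) 0 mu τ hτ z, jacobiSlash, denom_fromBlocks_one,
    moebius_fromBlocks_one]
  have h0 : (fun _ : Fin g => (0 : ℂ)) = 0 := rfl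
  simp [h0]

theorem toFun_add_vecMul {τ : Matrix (Fin g) (Fin g) ℂ} (hτ : τ ∈ siegelH g) (z : Fin g → ℂ)
    (lam : Fin g → ℤ) :
    e (m * (((fun i => (lam i : ℂ)) ᵥ* τ) ⬝ᵥ (fun i => (lam i : ℂ)) +
        2 * ((fun i => (lam i : ℂ)) ⬝ᵥ z))) *
      φ.toFun (τ, z + (fun i => (lam i : ℂ)) ᵥ* τ) = φ.toFun (τ, z) := by
  rw [← φ.invariant _ (fromBlocks_one_mem (S := 0) (by simp [Matrix.IsSymm])) lam 0 τ hτ z,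
    jacobiSlash, denom_fromBlocks_one, moebius_fromBlocks_one]
  have h0 : (fun _ : Fin g => (0 : ℂ)) = 0 := rfl
  simp [h0, dotProduct_comm, -fromBlocks_one]

/-- Invariance under `(τ, z) ↦ (τ + S, z + μ)`: the character of an index with nonzero coefficient
is trivial on integral translations. -/
theorem jacobiChar_int_eq_one {x : Matrix (Fin g) (Fin g) ℚ × (Fin g → ℚ)}
    (hx : φ.coeff x.1 x.2 ≠ 0) {S : Matrix (Fin g) (Fin g) ℤ} (hS : S.IsSymm) (mu : Fin g → ℤ) :
    jacobiChar x (S.map (Int.cast : ℤ → ℂ)) (fun i => (mu i : ℂ)) = 1 := by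
  have h := eq_zero_of_hasSum_jacobiChar (fun x => ι (φ.coeff x.1 x.2 : Qpur p) *
    (jacobiChar x (S.map (Int.cast : ℤ → ℂ)) (fun i => (mu i : ℂ)) - 1))
    (fun x hx => φ.isSymm_of_coeff_ne_zero (left_ne_zero_of_mul hx)) (fun τ hτ z => by
      have hτS : τ + S.map (Int.cast : ℤ → ℂ) ∈ siegelH g := by
        have := add_real_mem_siegelH hτ (S := S.map (Int.cast : ℤ → ℝ))
          (by rw [Matrix.IsSymm, ← Matrix.transpose_map, hS.eq])
        rwa [Matrix.map_map, show ((fun x : ℝ => (x : ℂ)) ∘ (Int.cast : ℤ → ℝ)) =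
          (Int.cast : ℤ → ℂ) by ext; simp] at this
      have h1 := (φ.hasSum_jacobiChar hτS (z + fun i => (mu i : ℂ))).sub (φ.hasSum_jacobiChar hτ z)
      rw [φ.toFun_add_int hτ z hS mu, sub_self] at h1
      refine h1.congr_fun fun x => ?_
      rw [jacobiChar_add]
      ring) x
  refine sub_eq_zero.mp ((mul_eq_zero.mp h).resolve_left ?_)
  rw [map_eq_zero]
  exact fun h0 => hx (Subtype.ext h0)

theorem exists_int_eq_snd {T : Matrix (Fin g) (Fin g) ℚ} {R : Fin g → ℚ} (h : φ.coeff T R ≠ 0)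
    (i : Fin g) : ∃ n : ℤ, R i = n := by
  have h1 := φ.jacobiChar_int_eq_one (x := (T, R)) h (S := 0) (by simp [Matrix.IsSymm])
    (Pi.single i 1)
  rw [jacobiChar, e_eq_one_iff] at h1
  obtain ⟨n, hn⟩ := h1
  refine ⟨n, ?_⟩
  have h2 : ∑ j, (((Pi.single i 1 : Fin g → ℤ) j : ℤ) : ℂ) * (R j : ℂ) = R i := by
    rw [Finset.sum_eq_single i (fun j _ hj => by simp [hj]) (by simp)]
    simp
  simp only [Matrix.map_zero _ Int.cast_zero, Matrix.mul_zero, Matrix.trace_zero, zero_add, h2]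
    at hn
  exact_mod_cast hn

theorem exists_int_eq_add {T : Matrix (Fin g) (Fin g) ℚ} {R : Fin g → ℚ} (h : φ.coeff T R ≠ 0)
    (i j : Fin g) : ∃ n : ℤ, T i i + T j j + 2 * T i j = n := by
  have hT := (φ.coeff_supp T R h).1
  -- The value of `T` at `v = e_i + e_j` is the trace of `T v vᵗ`.
  let v : Fin g → ℤ := Pi.single i 1 + Pi.single j 1
  have h1 := φ.jacobiChar_int_eq_one (x := (T, R)) h (S := vecMulVec v v)
    (by ext a b; simp [vecMulVec_apply, mul_comm]) 0
  rw [jacobiChar, e_eq_one_iff] at h1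
  obtain ⟨n, hn⟩ := h1
  refine ⟨n, ?_⟩
  rw [trace_map_mul] at hn
  have h2 : ∑ a, ∑ b, (T a b : ℂ) * ((vecMulVec v v).map (Int.cast : ℤ → ℂ)) b a =
      T i i + T j j + 2 * T i j := by
    have h3 : ∀ a b, ((vecMulVec v v).map (Int.cast : ℤ → ℂ)) b a =
        ((if a = i then 1 else 0) + (if a = j then 1 else 0)) *
        ((if b = i then 1 else 0) + (if b = j then 1 else 0)) := fun a b => by
      simp [vecMulVec_apply, v, Pi.single_apply, mul_comm]
    simp only [h3, mul_add, Finset.sum_add_distrib, mul_ite, mul_one, mul_zero, Finset.sum_ite_eq',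
      Finset.mem_univ, if_true]
    rw [hT.apply i j]
    ring
  rw [h2] at hn
  simp at hn
  exact_mod_cast hn

/-- Invariance under `z ↦ z + λ τ`. -/
theorem coeff_indexShift (lam : Fin g → ℤ) (x : Matrix (Fin g) (Fin g) ℚ × (Fin g → ℚ)) :
    φ.coeff (indexShift m (fun i => (lam i : ℚ)) x).1 (indexShift m (fun i => (lam i : ℚ)) x).2 =
      φ.coeff x.1 x.2 := by
  let σ := indexShiftEquiv m (fun i => (lam i : ℚ))
  have h := eq_zero_of_hasSum_jacobiChar (fun y => ι (φ.coeff y.1 y.2 : Qpur p) -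
      ι (φ.coeff (σ.symm y).1 (σ.symm y).2 : Qpur p)) (fun y hy => ?_) (fun τ hτ z => ?_) (σ x)
  · rw [σ.symm_apply_apply, sub_eq_zero] at h
    exact Subtype.ext (ι.injective h)
  · by_cases hy1 : ι (φ.coeff y.1 y.2 : Qpur p) = 0
    · have := φ.isSymm_of_coeff_ne_zero (x := σ.symm y) (fun h0 => hy (by rw [hy1, h0, sub_zero]))
      rw [← σ.apply_symm_apply y]
      exact indexShift_isSymm m _ this
    · exact φ.isSymm_of_coeff_ne_zero hy1
  · have h1 := (φ.hasSum_jacobiChar hτ (z + (fun i => (lam i : ℂ)) ᵥ* τ)).mul_left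
      (e (m * (((fun i => (lam i : ℂ)) ᵥ* τ) ⬝ᵥ (fun i => (lam i : ℂ)) +
        2 * ((fun i => (lam i : ℂ)) ⬝ᵥ z))))
    rw [φ.toFun_add_vecMul hτ z lam, ← σ.symm.hasSum_iff] at h1
    have h2 := (φ.hasSum_jacobiChar hτ z).sub h1
    rw [sub_self] at h2
    refine h2.congr_fun fun y => ?_
    have h3 := jacobiChar_indexShift m (fun i => (lam i : ℚ)) (σ.symm y) hτ.1 z
    simp only [Rat.cast_intCast] at h3
    rw [sub_mul]
    congr 1
    rw [Function.comp_apply, mul_left_comm, ← h3]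
    congr 2
    exact (σ.apply_symm_apply y).symm

end JacobiForm

end JacobiCoeff

/-! ### Siegel modular forms as formal power series -/

section SiegelSeries

open Matrix

variable {g : ℕ}

/-- The matrix `T` with `Q * T[e_i + e_j] = n_{ij}`. Through the integers `n_{ij} ≥ 0`, positive
semi-definite matrices with bounded denominators become exponents of monomials in the variables
`X_{ij}`; the diagonal entries satisfy `n_{ii} = 4 * Q * t_{ii}`. -/
def expMatrix (Q : ℕ) (n : Fin g × Fin g →₀ ℕ) : Matrix (Fin g) (Fin g) ℚ :=
  .of fun i j => ((n (i, j) : ℚ) - n (i, i) / 4 - n (j, j) / 4) / (2 * Q)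

theorem expMatrix_apply (Q : ℕ) (n : Fin g × Fin g →₀ ℕ) (i j : Fin g) :
    expMatrix Q n i j = ((n (i, j) : ℚ) - n (i, i) / 4 - n (j, j) / 4) / (2 * Q) := rfl

theorem expMatrix_add (Q : ℕ) (n n' : Fin g × Fin g →₀ ℕ) :
    expMatrix Q (n + n') = expMatrix Q n + expMatrix Q n' := by
  ext i j
  simp only [expMatrix_apply, Matrix.add_apply, Finsupp.add_apply]
  push_cast
  ring

theorem expMatrix_diag {Q : ℕ} (hQ : Q ≠ 0) (n : Fin g × Fin g →₀ ℕ) (i : Fin g) :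
    (n (i, i) : ℚ) = 4 * Q * expMatrix Q n i i := by
  have : (Q : ℚ) ≠ 0 := by exact_mod_cast hQ
  rw [expMatrix_apply]
  field_simp
  ring

theorem expMatrix_eq {Q : ℕ} (hQ : Q ≠ 0) (n : Fin g × Fin g →₀ ℕ) (i j : Fin g) :
    (n (i, j) : ℚ) =
      Q * (expMatrix Q n i i + expMatrix Q n j j + 2 * expMatrix Q n i j) := by
  have : (Q : ℚ) ≠ 0 := by exact_mod_cast hQ
  simp only [expMatrix_apply]
  field_simp
  ring

theorem expMatrix_injective {Q : ℕ} (hQ : Q ≠ 0) :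
    Function.Injective (expMatrix (g := g) Q) := by
  intro n n' h
  ext ⟨i, j⟩
  have h1 := expMatrix_eq hQ n i j
  rw [h, ← expMatrix_eq hQ n' i j] at h1
  exact_mod_cast h1

/-- A rational matrix that can be the index of a Fourier coefficient. -/
def IsIndex (T : Matrix (Fin g) (Fin g) ℚ) : Prop :=
  T.IsSymm ∧ (T.map (Rat.cast : ℚ → ℝ)).PosSemidef

theorem IsIndex.add {T T' : Matrix (Fin g) (Fin g) ℚ} (h : IsIndex T) (h' : IsIndex T') :
    IsIndex (T + T') := by
  refine ⟨h.1.add h'.1, ?_⟩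
  rw [Matrix.map_add _ (by simp)]
  exact h.2.add h'.2

theorem isIndex_zero : IsIndex (0 : Matrix (Fin g) (Fin g) ℚ) := by
  refine ⟨by simp [Matrix.IsSymm], ?_⟩
  rw [Matrix.map_zero _ (by simp)]
  exact Matrix.PosSemidef.zero

theorem expMatrix_zero (Q : ℕ) : expMatrix (g := g) Q 0 = 0 := by
  ext i j
  simp [expMatrix_apply]

/-- The character `e(tr(TZ))` in the Fourier expansion of a Siegel modular form. -/
def siegelChar (T : Matrix (Fin g) (Fin g) ℚ) (Z : Matrix (Fin g) (Fin g) ℂ) : ℂ :=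
  e (T.map (Rat.cast : ℚ → ℂ) * Z).trace

theorem siegelChar_add (T T' : Matrix (Fin g) (Fin g) ℚ) (Z : Matrix (Fin g) (Fin g) ℂ) :
    siegelChar (T + T') Z = siegelChar T Z * siegelChar T' Z := by
  rw [siegelChar, siegelChar, siegelChar, ← e_add, Matrix.map_add _ (by simp), Matrix.add_mul,
    Matrix.trace_add]

theorem siegelChar_zero (Z : Matrix (Fin g) (Fin g) ℂ) : siegelChar 0 Z = 1 := by
  simp [siegelChar, Matrix.map_zero _ Rat.cast_zero]

variable {p : ℕ} [Fact p.Prime]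

/-- `Φ` is a holomorphic function on the Siegel upper half space with Fourier expansion `f`, where
the exponents of `f` encode matrices through `expMatrix Q`. -/
structure IsExpansion (ι : Qpur p →+* ℂ) (Q : ℕ) (f : MvPowerSeries (Fin g × Fin g) (Op p))
    (Φ : Matrix (Fin g) (Fin g) ℂ → ℂ) : Prop where
  supp : ∀ n, f.coeff n ≠ 0 → IsIndex (expMatrix Q n)
  holo : DifferentiableOn ℂ Φ (siegelH g)
  hasSum : ∀ Z ∈ siegelH g,
    HasSum (fun n => ι (f.coeff n : Qpur p) * siegelChar (expMatrix Q n) Z) (Φ Z)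

namespace IsExpansion

variable {ι : Qpur p →+* ℂ} {Q : ℕ} {f f' : MvPowerSeries (Fin g × Fin g) (Op p)}
  {Φ Φ' : Matrix (Fin g) (Fin g) ℂ → ℂ}

theorem zero : IsExpansion (g := g) ι Q 0 0 where
  supp n hn := by simp at hn
  holo := differentiableOn_const (E := Fin g → Fin g → ℂ) 0
  hasSum Z _ := by simp

theorem one : IsExpansion (g := g) ι Q 1 1 where
  supp n hn := by
    classical
    rw [MvPowerSeries.coeff_one] at hn
    have : n = 0 := by by_contra h; simp [h] at hn
    rw [this, expMatrix_zero]
    exact isIndex_zero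
  holo := differentiableOn_const (E := Fin g → Fin g → ℂ) 1
  hasSum Z _ := by
    classical
    have h := hasSum_single (f := fun n => ι (((1 : MvPowerSeries (Fin g × Fin g) (Op p)).coeff n :
      Op p) : Qpur p) * siegelChar (expMatrix Q n) Z) 0 (fun n hn => by
        simp [MvPowerSeries.coeff_one, hn])
    simpa [expMatrix_zero, siegelChar_zero] using h

theorem add (h : IsExpansion ι Q f Φ) (h' : IsExpansion ι Q f' Φ') :
    IsExpansion ι Q (f + f') (Φ + Φ') where
  supp n hn := by
    by_cases h0 : f.coeff n = 0
    · exact h'.supp n fun h1 => hn (by rw [map_add, h0, h1, add_zero])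
    · exact h.supp n h0
  holo := DifferentiableOn.add (E := Fin g → Fin g → ℂ) h.holo h'.holo
  hasSum Z hZ := by
    refine ((h.hasSum Z hZ).add (h'.hasSum Z hZ)).congr_fun fun n => ?_
    simp [add_mul]

theorem neg (h : IsExpansion ι Q f Φ) : IsExpansion ι Q (-f) (-Φ) where
  supp n hn := h.supp n fun h0 => hn (by rw [map_neg, h0, neg_zero])
  holo := DifferentiableOn.neg (E := Fin g → Fin g → ℂ) h.holo
  hasSum Z hZ := by
    refine (h.hasSum Z hZ).neg.congr_fun fun n => ?_
    simp

theorem hasSum_antidiagonal {A : Type*} [AddCommMonoid A] [Finset.HasAntidiagonal A] {a b : A → ℂ}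
    {x y : ℂ} (ha : HasSum a x) (hb : HasSum b y) :
    HasSum (fun n => ∑ k ∈ Finset.HasAntidiagonal.antidiagonal n, a k.1 * b k.2) (x * y) := by
  have hs := summable_mul_of_summable_norm ha.summable.norm hb.summable.norm
  have ht := ha.summable.tsum_mul_tsum_eq_tsum_sum_antidiagonal hb.summable hs
  rw [ha.tsum_eq, hb.tsum_eq] at ht
  rw [ht]
  exact (summable_sum_mul_antidiagonal_of_summable_mul hs).hasSum

theorem coe_coeff_mul (ι : Qpur p →+* ℂ) (f f' : MvPowerSeries (Fin g × Fin g) (Op p))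
    (n : Fin g × Fin g →₀ ℕ) :
    ι ((f * f').coeff n : Qpur p) = ∑ x ∈ Finset.HasAntidiagonal.antidiagonal n,
      ι (f.coeff x.1 : Qpur p) * ι (f'.coeff x.2 : Qpur p) := by
  classical
  have h := MvPowerSeries.coeff_mul n f f'
  have h2 := congrArg (ι.comp (Op p).subtype) h
  rw [map_sum] at h2
  simp only [map_mul] at h2
  exact h2

theorem mul (h : IsExpansion ι Q f Φ) (h' : IsExpansion ι Q f' Φ') :
    IsExpansion ι Q (f * f') (Φ * Φ') where
  supp n hn := by
    classical
    rw [MvPowerSeries.coeff_mul] at hn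
    obtain ⟨x, hx, hne⟩ := Finset.exists_ne_zero_of_sum_ne_zero hn
    rw [← Finset.HasAntidiagonal.mem_antidiagonal.mp hx, expMatrix_add]
    exact (h.supp _ (left_ne_zero_of_mul hne)).add (h'.supp _ (right_ne_zero_of_mul hne))
  holo := DifferentiableOn.mul (E := Fin g → Fin g → ℂ) h.holo h'.holo
  hasSum Z hZ := by
    classical
    have hf := h.hasSum Z hZ
    have hf' := h'.hasSum Z hZ
    refine (hasSum_antidiagonal hf hf').congr_fun fun n => ?_
    rw [coe_coeff_mul, Finset.sum_mul]
    refine Finset.sum_congr rfl fun x hx => ?_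
    rw [← Finset.HasAntidiagonal.mem_antidiagonal.mp hx, expMatrix_add, siegelChar_add]
    ring

theorem sum {α : Type*} {f : α → MvPowerSeries (Fin g × Fin g) (Op p)}
    {Φ : α → Matrix (Fin g) (Fin g) ℂ → ℂ} (s : Finset α)
    (h : ∀ i ∈ s, IsExpansion ι Q (f i) (Φ i)) :
    IsExpansion ι Q (∑ i ∈ s, f i) (∑ i ∈ s, Φ i) := by
  classical
  induction s using Finset.induction_on with
  | empty => simpa using zero
  | insert a s ha ih =>
    rw [Finset.sum_insert ha, Finset.sum_insert ha]
    exact (h a (by simp)).add (ih fun i hi => h i (by simp [hi]))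

theorem prod {α : Type*} {f : α → MvPowerSeries (Fin g × Fin g) (Op p)}
    {Φ : α → Matrix (Fin g) (Fin g) ℂ → ℂ} (s : Finset α)
    (h : ∀ i ∈ s, IsExpansion ι Q (f i) (Φ i)) :
    IsExpansion ι Q (∏ i ∈ s, f i) (∏ i ∈ s, Φ i) := by
  classical
  induction s using Finset.induction_on with
  | empty => simpa using one
  | insert a s ha ih =>
    rw [Finset.prod_insert ha, Finset.prod_insert ha]
    exact (h a (by simp)).mul (ih fun i hi => h i (by simp [hi]))

end IsExpansion

/-- The Fourier expansions of Siegel modular forms of weight `w`. -/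
def formSeries (g : ℕ) (ι : Qpur p →+* ℂ) (Q w : ℕ) :
    AddSubgroup (MvPowerSeries (Fin g × Fin g) (Op p)) where
  carrier := {f | ∃ Φ, IsExpansion ι Q f Φ ∧ ∀ M ∈ symplecticGroup (Fin g) ℤ, ∀ Z ∈ siegelH g,
    Φ (moebius M Z) = (denom M Z).det ^ w * Φ Z}
  zero_mem' := ⟨0, .zero, by simp⟩
  add_mem' := by
    rintro f f' ⟨Φ, h, hΦ⟩ ⟨Φ', h', hΦ'⟩
    exact ⟨Φ + Φ', h.add h', fun M hM Z hZ => by simp [hΦ M hM Z hZ, hΦ' M hM Z hZ, mul_add]⟩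
  neg_mem' := by
    rintro f ⟨Φ, h, hΦ⟩
    exact ⟨-Φ, h.neg, fun M hM Z hZ => by simp [hΦ M hM Z hZ]⟩

instance (ι : Qpur p →+* ℂ) (Q : ℕ) : SetLike.GradedMonoid (formSeries g ι Q) where
  one_mem := ⟨1, .one, by simp⟩
  mul_mem := by
    rintro w w' f f' ⟨Φ, h, hΦ⟩ ⟨Φ', h', hΦ'⟩
    refine ⟨Φ * Φ', h.mul h', fun M hM Z hZ => ?_⟩
    simp only [Pi.mul_apply, hΦ M hM Z hZ, hΦ' M hM Z hZ, pow_add]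
    ring

theorem exists_siegelModularForm {ι : Qpur p →+* ℂ} {Q w : ℕ} (hQ : Q ≠ 0)
    {f : MvPowerSeries (Fin g × Fin g) (Op p)} (hf : f ∈ formSeries g ι Q w) :
    ∃ F : SiegelModularForm p ι g w, (∀ n, F.coeff (expMatrix Q n) = f.coeff n) ∧
      ∀ T, F.coeff T ≠ 0 → ∃ n, expMatrix Q n = T := by
  classical
  obtain ⟨Φ, h, hΦ⟩ := hf
  have hinj := expMatrix_injective (g := g) hQ
  let c : Matrix (Fin g) (Fin g) ℚ → Op p :=
    Function.extend (expMatrix Q) (fun n => f.coeff n) 0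
  have hc : ∀ n, c (expMatrix Q n) = f.coeff n := hinj.extend_apply _ _
  have hc' : ∀ T, c T ≠ 0 → ∃ n, expMatrix Q n = T := fun T hT => by
    by_contra hn
    exact hT (Function.extend_apply' _ _ _ hn)
  refine ⟨⟨Φ, c, h.holo, hΦ, fun T hT => ?_, fun Z hZ => ?_⟩, hc, hc'⟩
  · obtain ⟨n, rfl⟩ := hc' T hT
    rw [hc] at hT
    exact h.supp n hT
  · rw [← hinj.hasSum_iff]
    · refine (h.hasSum Z hZ).congr_fun fun n => ?_
      rw [Function.comp_apply, hc]
      rfl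
    · intro T hT
      have : c T = 0 := by
        by_contra h0
        exact hT (hc' T h0)
      simp [this]

/-- A Siegel modular form whose diagonal vanishing order is too large for the slope bound is zero
modulo `𝔭`. -/
theorem coeff_mem_of_slope {ι : Qpur p →+* ℂ} {Q w : ℕ} (hQ : Q ≠ 0) (hw : 1 ≤ w)
    {f : MvPowerSeries (Fin g × Fin g) (Op p)} (hf : f ∈ formSeries g ι Q w) (l : ℕ)
    (hl : ∀ n : Fin g × Fin g →₀ ℕ, (∀ i, n (i, i) ≤ 4 * Q * l) → f.coeff n ∈ primeP p)
    (hslope : (w : ℝ≥0∞) < diagSlopeBound p ι g * l) (n : Fin g × Fin g →₀ ℕ) :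
    f.coeff n ∈ primeP p := by
  obtain ⟨F, hF, hF'⟩ := exists_siegelModularForm hQ hf
  have hQ' : (0 : ℚ) < Q := by exact_mod_cast Nat.pos_of_ne_zero hQ
  by_contra hn
  have hne : ¬ F.IsZeroMod := fun h0 => hn (hF n ▸ h0 _)
  have hord : (l : ℕ∞) ≤ F.diagOrd := by
    refine le_iSup₂_of_le (f := fun (l : ℕ) (_ : ∀ T : Matrix (Fin g) (Fin g) ℚ,
      (∀ i, T i i ≤ l) → F.coeff T ∈ primeP p) => (l : ℕ∞)) l (fun T hT => ?_) le_rfl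
    by_cases h0 : F.coeff T = 0
    · rw [h0]; exact zero_mem _
    · obtain ⟨n, rfl⟩ := hF' T h0
      rw [hF]
      refine hl n fun i => ?_
      have h1 := expMatrix_diag hQ n i
      have h2 : (n (i, i) : ℚ) ≤ 4 * Q * l := by
        rw [h1]
        exact mul_le_mul_of_nonneg_left (hT i) (by positivity)
      exact_mod_cast h2
  have hρ : diagSlopeBound p ι g ≤ (w : ℝ≥0∞) / (F.diagOrd : ℝ≥0∞) :=
    iInf₂_le_of_le w hw (iInf₂_le F hne)
  have hl0 : (l : ℝ≥0∞) ≠ 0 := by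
    intro h0
    rw [h0, mul_zero] at hslope
    exact not_lt_bot hslope
  have hord' : (l : ℝ≥0∞) ≤ (F.diagOrd : ℝ≥0∞) := by
    have := ENat.toENNReal_le.mpr hord
    simpa using this
  refine absurd hslope (not_lt.mpr ?_)
  calc diagSlopeBound p ι g * l ≤ (w : ℝ≥0∞) / l * l := by
        gcongr
        exact hρ.trans (ENNReal.div_le_div_left hord' _)
    _ = w := ENNReal.div_mul_cancel hl0 (ENNReal.natCast_ne_top l)

end SiegelSeries

/-! ### Restriction of Jacobi forms to torsion points -/

section Torsion

open Matrix

variable {g : ℕ}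

section Symplectic

variable {M : Matrix (Fin g ⊕ Fin g) (Fin g ⊕ Fin g) ℤ}

theorem symplectic_columns (hM : M ∈ symplecticGroup (Fin g) ℤ) {S : Type*} [CommRing S]
    (f : ℤ →+* S) :
    (M.toBlocks₁₁.map f)ᵀ * M.toBlocks₂₁.map f = (M.toBlocks₂₁.map f)ᵀ * M.toBlocks₁₁.map f ∧
    (M.toBlocks₁₂.map f)ᵀ * M.toBlocks₂₂.map f = (M.toBlocks₂₂.map f)ᵀ * M.toBlocks₁₂.map f ∧
    (M.toBlocks₁₁.map f)ᵀ * M.toBlocks₂₂.map f - (M.toBlocks₂₁.map f)ᵀ * M.toBlocks₁₂.map f =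
      1 := by
  have h := SymplecticGroup.map_mem (f := f) hM
  rw [← fromBlocks_toBlocks M] at h
  exact SymplecticGroup.fromBlocks_mem_iff.mp (by simpa [fromBlocks_map] using h)

theorem symplectic_rows (hM : M ∈ symplecticGroup (Fin g) ℤ) {S : Type*} [CommRing S]
    (f : ℤ →+* S) :
    M.toBlocks₁₁.map f * (M.toBlocks₁₂.map f)ᵀ = M.toBlocks₁₂.map f * (M.toBlocks₁₁.map f)ᵀ ∧
    M.toBlocks₂₁.map f * (M.toBlocks₂₂.map f)ᵀ = M.toBlocks₂₂.map f * (M.toBlocks₂₁.map f)ᵀ ∧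
    M.toBlocks₁₁.map f * (M.toBlocks₂₂.map f)ᵀ - M.toBlocks₁₂.map f * (M.toBlocks₂₁.map f)ᵀ =
      1 := by
  have h := SymplecticGroup.transpose_mem (SymplecticGroup.map_mem (f := f) hM)
  rw [← fromBlocks_toBlocks M] at h
  have h1 := SymplecticGroup.fromBlocks_mem_iff.mp
    (by simpa [fromBlocks_map, fromBlocks_transpose] using h)
  simpa using h1

/-- `C τ + D` is invertible: for a vector `v` in its kernel, the identity
`(A τ + B)ᵗ (C τ̄ + D) - (C τ + D)ᵗ (A τ̄ + B) = τ - τ̄ = 2 i Im τ` gives `vᵗ (Im τ) v̄ = 0`. -/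
theorem det_denom_ne_zero (hM : M ∈ symplecticGroup (Fin g) ℤ) {τ : Matrix (Fin g) (Fin g) ℂ}
    (hτ : τ ∈ siegelH g) : (denom M τ).det ≠ 0 := by
  intro hdet
  obtain ⟨v, hv0, hv⟩ := Matrix.exists_mulVec_eq_zero_iff.mpr hdet
  obtain ⟨h1, h2, h3⟩ := symplectic_columns hM (Int.castRingHom ℂ)
  simp only [Int.coe_castRingHom] at h1 h2 h3
  have h4 := congrArg Matrix.transpose h3
  simp only [transpose_sub, transpose_mul, transpose_transpose, transpose_one] at h4
  rw [denom] at hv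
  set A := M.toBlocks₁₁.map (Int.cast : ℤ → ℂ) with hA
  set B := M.toBlocks₁₂.map (Int.cast : ℤ → ℂ) with hB
  set C := M.toBlocks₂₁.map (Int.cast : ℤ → ℂ) with hC
  set D := M.toBlocks₂₂.map (Int.cast : ℤ → ℂ) with hD
  set τ' := τ.map (starRingEnd ℂ) with hτ'
  have hτs : τᵀ = τ := hτ.1
  have hkey : (A * τ + B)ᵀ * (C * τ' + D) - (C * τ + D)ᵀ * (A * τ' + B) = τ - τ' := by
    have : (A * τ + B)ᵀ * (C * τ' + D) - (C * τ + D)ᵀ * (A * τ' + B) =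
        τᵀ * (Aᵀ * C - Cᵀ * A) * τ' + τᵀ * (Aᵀ * D - Cᵀ * B) - (Dᵀ * A - Bᵀ * C) * τ' +
          (Bᵀ * D - Dᵀ * B) := by
      simp only [transpose_add, transpose_mul]
      noncomm_ring
    rw [this, h1, h2, h3, h4, hτs]
    simp
  have hconj : (C * τ' + D) *ᵥ (star v) = 0 := by
    have h5 := congrArg star hv
    have h6 : C * τ' + D = (C * τ + D).map (starRingEnd ℂ) := by
      ext i j
      simp [hC, hD, hτ', Matrix.mul_apply]
    rw [h6]
    ext i
    have h7 := congrFun h5 i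
    simp only [Pi.star_apply, mulVec, dotProduct, star_sum, star_mul', Pi.zero_apply,
      star_zero] at h7
    simpa [mulVec, dotProduct] using h7
  have hzero : v ⬝ᵥ ((τ - τ') *ᵥ star v) = 0 := by
    rw [← hkey, sub_mulVec, dotProduct_sub, ← mulVec_mulVec, hconj, ← mulVec_mulVec,
      dotProduct_mulVec v (C * τ + D)ᵀ, vecMul_transpose, hv]
    simp
  have hY : τ - τ' = (2 * Complex.I) • (τ.map Complex.im).map (fun x : ℝ => (x : ℂ)) := by
    ext i j
    simp only [hτ', Matrix.sub_apply, map_apply, Matrix.smul_apply, smul_eq_mul]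
    rw [Complex.sub_conj]
    push_cast
    ring
  rw [hY, smul_mulVec, dotProduct_smul, smul_eq_mul, mul_eq_zero] at hzero
  replace hzero := hzero.resolve_left (by simp)
  have hpd := hτ.2
  have hre : (v ⬝ᵥ ((τ.map Complex.im).map (fun x : ℝ => (x : ℂ)) *ᵥ star v)).re =
      (fun i => (v i).re) ⬝ᵥ (τ.map Complex.im *ᵥ fun i => (v i).re) +
        (fun i => (v i).im) ⬝ᵥ (τ.map Complex.im *ᵥ fun i => (v i).im) := by
    simp only [dotProduct, mulVec, Complex.re_sum, Finset.mul_sum, map_apply, ←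
      Finset.sum_add_distrib]
    refine Finset.sum_congr rfl fun i _ => Finset.sum_congr rfl fun j _ => ?_
    simp
  rw [hzero, Complex.zero_re] at hre
  have hnn : ∀ w : Fin g → ℝ, 0 ≤ w ⬝ᵥ (τ.map Complex.im *ᵥ w) := fun w => by
    simpa using hpd.posSemidef.dotProduct_mulVec_nonneg w
  have hpos : ∀ w : Fin g → ℝ, w ⬝ᵥ (τ.map Complex.im *ᵥ w) = 0 → w = 0 := fun w hw => by
    by_contra h0
    have := hpd.dotProduct_mulVec_pos h0
    simp [hw] at this
  have hr := hpos _ (le_antisymm (by linarith [hnn fun i => (v i).im]) (hnn fun i => (v i).re))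
  have hi := hpos _ (le_antisymm (by linarith [hnn fun i => (v i).re]) (hnn fun i => (v i).im))
  exact hv0 (funext fun i => Complex.ext (congrFun hr i) (congrFun hi i))

/-- The exponent of the automorphy factor of Jacobi forms at the point `z = λ' τ + μ'`, where
`(λ', μ') = (λ, μ) M`. -/
theorem exponent_moebius (hM : M ∈ symplecticGroup (Fin g) ℤ) {τ : Matrix (Fin g) (Fin g) ℂ}
    (hτ : τ ∈ siegelH g) (lam mu : Fin g → ℂ) :
    let A := M.toBlocks₁₁.map (Int.cast : ℤ → ℂ)
    let B := M.toBlocks₁₂.map (Int.cast : ℤ → ℂ)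
    let C := M.toBlocks₂₁.map (Int.cast : ℤ → ℂ)
    let D := M.toBlocks₂₂.map (Int.cast : ℤ → ℂ)
    let z := (lam ᵥ* A + mu ᵥ* C) ᵥ* τ + (lam ᵥ* B + mu ᵥ* D)
    z ᵥ* (denom M τ)⁻¹ = lam ᵥ* moebius M τ + mu ∧
    (lam ᵥ* moebius M τ) ⬝ᵥ lam + lam ⬝ᵥ mu + (z ᵥ* ((denom M τ)⁻¹ * C)) ⬝ᵥ z =
      ((lam ᵥ* A + mu ᵥ* C) ᵥ* τ) ⬝ᵥ (lam ᵥ* A + mu ᵥ* C) +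
        (lam ᵥ* A + mu ᵥ* C) ⬝ᵥ (lam ᵥ* B + mu ᵥ* D) := by
  intro A B C D z
  obtain ⟨h1, h2, h3⟩ := symplectic_rows hM (Int.castRingHom ℂ)
  simp only [Int.coe_castRingHom] at h1 h2 h3
  change A * Bᵀ = B * Aᵀ at h1
  change C * Dᵀ = D * Cᵀ at h2
  change A * Dᵀ - B * Cᵀ = 1 at h3
  have h4 : D * Aᵀ - C * Bᵀ = 1 := by
    have := congrArg Matrix.transpose h3
    simpa only [transpose_sub, transpose_mul, transpose_transpose, transpose_one] using this
  have hτs : τᵀ = τ := hτ.1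
  have hJu : IsUnit (denom M τ).det := (det_denom_ne_zero hM hτ).isUnit
  have hJ : denom M τ = C * τ + D := rfl
  have hW : moebius M τ = (A * τ + B) * (denom M τ)⁻¹ := rfl
  set J := denom M τ with hJdef
  set W := moebius M τ with hWdef
  have hWJ : W * J = A * τ + B := by rw [hW, Matrix.mul_assoc, nonsing_inv_mul _ hJu, mul_one]
  have hz : z = lam ᵥ* (A * τ + B) + mu ᵥ* J := by
    simp only [z, hJ, add_vecMul, vecMul_add, vecMul_vecMul]
    abel
  have hzJ : z ᵥ* J⁻¹ = lam ᵥ* W + mu := by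
    rw [hz, add_vecMul, vecMul_vecMul, vecMul_vecMul, mul_nonsing_inv _ hJu, vecMul_one, ← hW]
  refine ⟨hzJ, ?_⟩
  -- The two matrix identities behind the cocycle relation.
  have i1 : W * (1 + C * (A * τ + B)ᵀ) = A * (A * τ + B)ᵀ := by
    have : 1 + C * (A * τ + B)ᵀ = J * Aᵀ := by
      rw [hJ, ← h4, transpose_add, transpose_mul, hτs]
      noncomm_ring
    rw [this, ← Matrix.mul_assoc, hWJ, transpose_add, transpose_mul, hτs, Matrix.mul_add, h1]
    noncomm_ring
  have i2 : W * (C * Jᵀ) + 1 = A * Jᵀ := by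
    have : C * Jᵀ = J * Cᵀ := by
      rw [hJ, transpose_add, transpose_mul, hτs, Matrix.mul_add, h2]
      noncomm_ring
    rw [this, ← Matrix.mul_assoc, hWJ, hJ, ← h3, transpose_add, transpose_mul, hτs]
    noncomm_ring
  have i3 : W *ᵥ (lam + C *ᵥ z) + mu = A *ᵥ z := by
    have hz' : z = (A * τ + B)ᵀ *ᵥ lam + Jᵀ *ᵥ mu := by
      rw [mulVec_transpose, mulVec_transpose, hz]
    calc W *ᵥ (lam + C *ᵥ z) + mu
        = (W * (1 + C * (A * τ + B)ᵀ)) *ᵥ lam + (W * (C * Jᵀ) + 1) *ᵥ mu := by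
          rw [hz']
          simp only [mulVec_add, add_mulVec, mulVec_mulVec, Matrix.mul_add, Matrix.mul_one,
            one_mulVec]
          abel
      _ = A *ᵥ z := by rw [i1, i2, hz', mulVec_add, mulVec_mulVec, mulVec_mulVec]
  have e1 : (z ᵥ* (J⁻¹ * C)) ⬝ᵥ z = lam ⬝ᵥ (W *ᵥ (C *ᵥ z)) + mu ⬝ᵥ (C *ᵥ z) := by
    rw [← vecMul_vecMul, hzJ, ← dotProduct_mulVec, add_dotProduct, ← dotProduct_mulVec]
  have e2 : (lam ᵥ* W) ⬝ᵥ lam = lam ⬝ᵥ (W *ᵥ lam) := by rw [← dotProduct_mulVec]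
  have e3 : ((lam ᵥ* A + mu ᵥ* C) ᵥ* τ) ⬝ᵥ (lam ᵥ* A + mu ᵥ* C) +
      (lam ᵥ* A + mu ᵥ* C) ⬝ᵥ (lam ᵥ* B + mu ᵥ* D) = lam ⬝ᵥ (A *ᵥ z) + mu ⬝ᵥ (C *ᵥ z) := by
    rw [dotProduct_comm _ (lam ᵥ* A + mu ᵥ* C), ← dotProduct_add]
    change (lam ᵥ* A + mu ᵥ* C) ⬝ᵥ z = _
    rw [add_dotProduct, ← dotProduct_mulVec, ← dotProduct_mulVec]
  rw [e1, e2, e3, ← i3, mulVec_add W, dotProduct_add, dotProduct_add]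
  ring

end Symplectic

namespace JacobiForm

variable {p : ℕ} [Fact p.Prime] {ι : Qpur p →+* ℂ} {k m : ℕ} (φ : JacobiForm p ι g k m)

/-- The restriction of a Jacobi form to the points `z = λ τ + μ`, normalized by an exponential
factor that makes it transform like a modular form. -/
def torsionFun (lam mu : Fin g → ℂ) (τ : Matrix (Fin g) (Fin g) ℂ) : ℂ :=
  e (m * ((lam ᵥ* τ) ⬝ᵥ lam + lam ⬝ᵥ mu)) * φ.toFun (τ, lam ᵥ* τ + mu)

theorem torsionFun_moebius {M : Matrix (Fin g ⊕ Fin g) (Fin g ⊕ Fin g) ℤ}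
    (hM : M ∈ symplecticGroup (Fin g) ℤ) {τ : Matrix (Fin g) (Fin g) ℂ}
    (hτ : τ ∈ siegelH g) (lam mu : Fin g → ℂ) :
    φ.torsionFun lam mu (moebius M τ) = (denom M τ).det ^ k *
      φ.torsionFun (lam ᵥ* M.toBlocks₁₁.map (Int.cast : ℤ → ℂ) +
          mu ᵥ* M.toBlocks₂₁.map (Int.cast : ℤ → ℂ))
        (lam ᵥ* M.toBlocks₁₂.map (Int.cast : ℤ → ℂ) +
          mu ᵥ* M.toBlocks₂₂.map (Int.cast : ℤ → ℂ)) τ := by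
  obtain ⟨h1, h2⟩ := exponent_moebius hM hτ lam mu
  have hJ := pow_ne_zero k (det_denom_ne_zero hM hτ)
  rw [torsionFun, torsionFun, ← h2, ← φ.invariant M hM 0 0 τ hτ, jacobiSlash]
  have h0 : (fun i => (((0 : Fin g → ℤ) i : ℤ) : ℂ)) = 0 := by ext; simp
  simp only [h0, zero_vecMul, add_zero, zero_dotProduct, mul_zero]
  rw [h1]
  have h3 : ∀ a b d x : ℂ, d ≠ 0 →
      e (m * a) * x = d * (e (m * (a + b)) * (d⁻¹ * e (m * -b) * x)) :=
    fun a b d x hd => by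
      rw [mul_add, e_add, mul_neg, e_neg]
      have := e_ne_zero (m * b)
      field_simp
  exact h3 _ _ _ _ hJ

theorem torsionFun_add_int {τ : Matrix (Fin g) (Fin g) ℂ} (hτ : τ ∈ siegelH g)
    (lam mu : Fin g → ℂ) (a b : Fin g → ℤ) :
    φ.torsionFun (lam + fun i => (a i : ℂ)) (mu + fun i => (b i : ℂ)) τ =
      e (m * (lam ⬝ᵥ (fun i => (b i : ℂ)) - (fun i => (a i : ℂ)) ⬝ᵥ mu)) *
        φ.torsionFun lam mu τ := by
  have h1 := φ.toFun_add_vecMul hτ (lam ᵥ* τ + mu) a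
  have h2 := φ.toFun_add_int hτ (lam ᵥ* τ + mu + (fun i => (a i : ℂ)) ᵥ* τ) (S := 0)
    (by simp [Matrix.IsSymm]) b
  rw [Matrix.map_zero _ Int.cast_zero, add_zero] at h2
  have hab : e (m * ((fun i => (a i : ℂ)) ⬝ᵥ (fun i => (b i : ℂ)))) = 1 :=
    e_eq_one_iff.mpr ⟨m * (a ⬝ᵥ b), by simp [dotProduct]⟩
  have hsymm : (lam ᵥ* τ) ⬝ᵥ (fun i => (a i : ℂ)) = ((fun i => (a i : ℂ)) ᵥ* τ) ⬝ᵥ lam := by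
    have hτs : τᵀ = τ := hτ.1
    rw [← dotProduct_mulVec, dotProduct_comm, ← vecMul_transpose, hτs]
  rw [torsionFun, torsionFun, ← h1, ← h2]
  have h3 : (lam + fun i => (a i : ℂ)) ᵥ* τ + (mu + fun i => (b i : ℂ)) =
      lam ᵥ* τ + mu + (fun i => (a i : ℂ)) ᵥ* τ + fun i => (b i : ℂ) := by
    rw [add_vecMul]; abel
  rw [h3, ← mul_assoc, ← mul_assoc, ← e_add, ← e_add,
    ← mul_one (e (_ + _)), ← hab, ← e_add]
  congr 2
  simp only [add_vecMul, add_dotProduct, dotProduct_add, hsymm,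
    dotProduct_comm (fun i => (a i : ℂ)) (lam ᵥ* τ)]
  ring

theorem differentiableOn_torsionFun (lam mu : Fin g → ℂ) :
    DifferentiableOn ℂ (φ.torsionFun lam mu) (siegelH g) := by
  have h1 : DifferentiableOn ℂ (fun τ : Fin g → Fin g → ℂ =>
      (τ, fun j => (∑ i, lam i * τ i j) + mu j))
      (siegelH g) := by
    fun_prop
  have h2 : DifferentiableOn ℂ (fun τ : Fin g → Fin g → ℂ =>
      e (m * ((∑ j, (∑ i, lam i * τ i j) * lam j) + lam ⬝ᵥ mu))) (siegelH g) := by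
    unfold e
    fun_prop
  exact h2.mul (DifferentiableOn.comp (E := Fin g → Fin g → ℂ)
    (F := (Fin g → Fin g → ℂ) × (Fin g → ℂ)) φ.holo h1 fun τ hτ => ⟨hτ, trivial⟩)

end JacobiForm

end Torsion

/-! ### Fourier expansions of the restrictions to torsion points -/

section TorsionSeries

open Matrix

variable {g : ℕ}

theorem indexShift_invariant (m : ℕ) (lam : Fin g → ℚ) (x) (i j : Fin g) :
    4 * m * (indexShift m lam x).1 i j - (indexShift m lam x).2 i * (indexShift m lam x).2 j =
      4 * m * x.1 i j - x.2 i * x.2 j := by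
  simp only [indexShift_fst_apply, indexShift_snd_apply]
  ring

theorem isIndex_indexShift {m : ℕ} (hm : 1 ≤ m) (lam : Fin g → ℚ)
    {x : Matrix (Fin g) (Fin g) ℚ × (Fin g → ℚ)} (hx : x.1.IsSymm)
    (hd : (((4 * m : ℚ) • x.1 - vecMulVec x.2 x.2).map (Rat.cast : ℚ → ℝ)).PosSemidef) :
    IsIndex (indexShift m lam x).1 := by
  refine ⟨indexShift_isSymm m lam hx, ?_⟩
  have hm' : (0 : ℝ) < m := by exact_mod_cast hm
  have h1 := (hd.add (posSemidef_vecMulVec_self_star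
    (fun i => ((indexShift m lam x).2 i : ℝ)))).smul (by positivity : (0 : ℝ) ≤ (4 * (m : ℝ))⁻¹)
  convert! h1 using 1
  ext i j
  have h2 := congrArg (Rat.cast : ℚ → ℝ) (indexShift_invariant m lam x i j)
  push_cast at h2
  simp only [Matrix.map_apply, Matrix.smul_apply, Matrix.add_apply, Matrix.sub_apply,
    vecMulVec_apply, star_trivial, smul_eq_mul]
  push_cast
  rw [← h2]
  field_simp
  ring

/-- The value of the quadratic form of a Fourier index at `e_i + e_j`. -/
theorem IsIndex.add_nonneg {T : Matrix (Fin g) (Fin g) ℚ} (h : IsIndex T) (i j : Fin g) :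
    0 ≤ T i i + T j j + 2 * T i j := by
  have h1 := h.2.dotProduct_mulVec_nonneg (Pi.single i 1 + Pi.single j 1)
  have h2 : star (Pi.single i 1 + Pi.single j 1 : Fin g → ℝ) = Pi.single i 1 + Pi.single j 1 := by
    ext; simp
  rw [h2, mulVec_add, dotProduct_add, add_dotProduct, add_dotProduct] at h1
  simp only [mulVec_single_one, single_one_dotProduct, Matrix.col_apply, Matrix.map_apply] at h1
  rw [h.1.apply i j] at h1
  have h3 : (0 : ℝ) ≤ ((T i i + T j j + 2 * T i j : ℚ) : ℝ) := by
    push_cast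
    linarith
  exact_mod_cast h3

/-- The exponent encoding the translated index `indexShift m lam x` (a junk value if that index is
not positive semi-definite with suitable denominators). -/
def shiftExp (m Q : ℕ) (lam : Fin g → ℚ) (x : Matrix (Fin g) (Fin g) ℚ × (Fin g → ℚ)) :
    Fin g × Fin g →₀ ℕ :=
  Finsupp.equivFunOnFinite.symm fun ij => ⌊(Q : ℚ) * ((indexShift m lam x).1 ij.1 ij.1 +
    (indexShift m lam x).1 ij.2 ij.2 + 2 * (indexShift m lam x).1 ij.1 ij.2)⌋₊

theorem expMatrix_shiftExp {m Q : ℕ} (hQ : Q ≠ 0) (lam : Fin g → ℚ)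
    {x : Matrix (Fin g) (Fin g) ℚ × (Fin g → ℚ)} (hx : IsIndex (indexShift m lam x).1)
    (hint : ∀ i j, ∃ n : ℤ, (Q : ℚ) * ((indexShift m lam x).1 i i +
      (indexShift m lam x).1 j j + 2 * (indexShift m lam x).1 i j) = n) :
    expMatrix Q (shiftExp m Q lam x) = (indexShift m lam x).1 := by
  have hQ' : (Q : ℚ) ≠ 0 := by exact_mod_cast hQ
  have h1 : ∀ i j, (shiftExp m Q lam x (i, j) : ℚ) = (Q : ℚ) * ((indexShift m lam x).1 i i +
      (indexShift m lam x).1 j j + 2 * (indexShift m lam x).1 i j) := by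
    intro i j
    obtain ⟨n, hn⟩ := hint i j
    have h0 : 0 ≤ (Q : ℚ) * ((indexShift m lam x).1 i i +
      (indexShift m lam x).1 j j + 2 * (indexShift m lam x).1 i j) :=
      mul_nonneg (Nat.cast_nonneg Q) (hx.add_nonneg i j)
    rw [hn] at h0 ⊢
    have h2 : shiftExp m Q lam x (i, j) = ⌊(n : ℚ)⌋₊ := by
      rw [← hn]; rfl
    have hn0 : 0 ≤ n := by exact_mod_cast h0
    rw [h2, natCast_floor_eq_intCast_floor h0, Int.floor_intCast]
  ext i j
  rw [expMatrix_apply, h1, h1, h1]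
  field_simp
  ring

namespace JacobiForm

variable {p : ℕ} [Fact p.Prime] {ι : Qpur p →+* ℂ} {k m : ℕ} (φ : JacobiForm p ι g k m)

/-- The `Q`-th root of unity `e(b R / N + m a b / N²)`, with `Q = N²`, by which the Fourier
coefficient of index `x = (T, R)` is multiplied on restriction to `z = (a τ + b) / N`. -/
def torsionPhase (m N : ℕ) (ζ : (Op p)ˣ) (a b : Fin g → ℤ)
    (x : Matrix (Fin g) (Fin g) ℚ × (Fin g → ℚ)) : (Op p)ˣ :=
  ζ ^ ⌊(N : ℚ) * ∑ i, (b i : ℚ) * x.2 i + m * ∑ i, (a i : ℚ) * b i⌋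

/-- The contribution of the index `x` to the Fourier expansion of the restriction to the torsion
point `(a τ + b) / N`. -/
def torsionTerm (N : ℕ) (ζ : (Op p)ˣ) (a b : Fin g → ℤ)
    (x : Matrix (Fin g) (Fin g) ℚ × (Fin g → ℚ)) : Op p :=
  φ.coeff x.1 x.2 * torsionPhase m N ζ a b x

/-- The Fourier expansion of the restriction to the torsion point `(a τ + b) / N`. -/
def torsionSeries (N : ℕ) (ζ : (Op p)ˣ) (a b : Fin g → ℤ) :
    MvPowerSeries (Fin g × Fin g) (Op p) := fun n =>
  ∑ᶠ x : {x // shiftExp m (N ^ 2) (fun i => (a i : ℚ) / N) x = n}, φ.torsionTerm N ζ a b x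

variable {φ} {N : ℕ} {ζ : (Op p)ˣ} {a b : Fin g → ℤ}

theorem sq_le_of_coeff_ne_zero {T : Matrix (Fin g) (Fin g) ℚ} {R : Fin g → ℚ}
    (h : φ.coeff T R ≠ 0) (i : Fin g) : R i * R i ≤ 4 * m * T i i := by
  have h1 := (φ.coeff_supp T R h).2.2.diag_nonneg (i := i)
  simp only [Matrix.map_apply, Matrix.sub_apply, Matrix.smul_apply, vecMulVec_apply,
    smul_eq_mul] at h1
  have h2 : 0 ≤ 4 * m * T i i - R i * R i := by exact_mod_cast h1
  linarith

theorem isIndex_of_coeff_ne_zero (hm : 1 ≤ m) (lam : Fin g → ℚ)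
    {x : Matrix (Fin g) (Fin g) ℚ × (Fin g → ℚ)} (h : φ.coeff x.1 x.2 ≠ 0) :
    IsIndex (indexShift m lam x).1 :=
  isIndex_indexShift hm lam (φ.coeff_supp _ _ h).1 (φ.coeff_supp _ _ h).2.2

theorem expMatrix_of_coeff_ne_zero (hm : 1 ≤ m) (hN : N ≠ 0) (a : Fin g → ℤ)
    {x : Matrix (Fin g) (Fin g) ℚ × (Fin g → ℚ)} (h : φ.coeff x.1 x.2 ≠ 0) :
    expMatrix (N ^ 2) (shiftExp m (N ^ 2) (fun i => (a i : ℚ) / N) x) =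
      (indexShift m (fun i => (a i : ℚ) / N) x).1 := by
  refine expMatrix_shiftExp (pow_ne_zero 2 hN) _ (isIndex_of_coeff_ne_zero hm _ h) fun i j => ?_
  have hN' : (N : ℚ) ≠ 0 := by exact_mod_cast hN
  obtain ⟨n, hn⟩ := φ.exists_int_eq_add h i j
  obtain ⟨r, hr⟩ := φ.exists_int_eq_snd h i
  obtain ⟨s, hs⟩ := φ.exists_int_eq_snd h j
  refine ⟨N ^ 2 * n + N * (a i + a j) * (r + s) + m * (a i + a j) ^ 2, ?_⟩
  simp only [indexShift_fst_apply, hr, hs]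
  push_cast
  rw [← hn]
  field_simp
  ring

theorem finite_fiber (hm : 1 ≤ m) (hN : N ≠ 0) (n : Fin g × Fin g →₀ ℕ) :
    {x : Matrix (Fin g) (Fin g) ℚ × (Fin g → ℚ) |
      shiftExp m (N ^ 2) (fun i => (a i : ℚ) / N) x = n ∧ φ.coeff x.1 x.2 ≠ 0}.Finite := by
  set lam : Fin g → ℚ := fun i => (a i : ℚ) / N with hlam
  let T := expMatrix (N ^ 2) n
  let c : Fin g → ℤ := fun i => ⌈|4 * m * T i i| + 1 + |2 * m * lam i|⌉
  have hfin : (Set.pi Set.univ fun i => Set.Icc (-c i) (c i)).Finite :=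
    Set.Finite.pi fun i => Set.finite_Icc _ _
  refine ((hfin.image fun (r : Fin g → ℤ) => (fun i => (r i : ℚ))).image fun R =>
    indexShift m (-lam) (T, R + (2 * m : ℚ) • lam)).subset ?_
  rintro x ⟨hx, hc⟩
  have hT : (indexShift m lam x).1 = T := by
    rw [← expMatrix_of_coeff_ne_zero hm hN a hc, hx]
  refine ⟨x.2, ?_, ?_⟩
  · choose r hr using φ.exists_int_eq_snd hc
    refine ⟨r, fun i _ => ?_, funext fun i => (hr i).symm⟩
    have h1 := indexShift_invariant m lam x i i
    have h2 := sq_le_of_coeff_ne_zero hc i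
    rw [hT, indexShift_snd_apply] at h1
    have h3 : (x.2 i + 2 * m * lam i) ^ 2 ≤ |4 * m * T i i| := by
      refine le_trans ?_ (le_abs_self _)
      linarith
    have h4 : |x.2 i + 2 * m * lam i| ≤ |4 * m * T i i| + 1 := by
      nlinarith [sq_abs (x.2 i + 2 * m * lam i), abs_nonneg (x.2 i + 2 * m * lam i)]
    have h5 : |x.2 i| ≤ |4 * m * T i i| + 1 + |2 * m * lam i| := by
      calc |x.2 i| = |(x.2 i + 2 * m * lam i) - 2 * m * lam i| := by ring_nf
        _ ≤ _ := (abs_sub _ _).trans (by gcongr)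
    have h6 : |x.2 i| ≤ c i := h5.trans (Int.le_ceil _)
    rw [hr i] at h6
    have h7 : |r i| ≤ c i := by exact_mod_cast h6
    exact abs_le.mp h7
  · have h1 : (indexShift m lam x) = (T, x.2 + (2 * m : ℚ) • lam) := Prod.ext hT rfl
    simp only
    rw [← h1, indexShift_neg_indexShift]

theorem finite_support_torsionTerm (hm : 1 ≤ m) (hN : N ≠ 0) (n : Fin g × Fin g →₀ ℕ) :
    (Function.support fun x : {x // shiftExp m (N ^ 2) (fun i => (a i : ℚ) / N) x = n} =>
      φ.torsionTerm N ζ a b x).Finite := by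
  refine ((finite_fiber (φ := φ) (a := a) hm hN n).preimage
    (Subtype.val_injective.injOn)).subset fun x hx => ?_
  exact ⟨x.2, left_ne_zero_of_mul hx⟩

theorem coeff_torsionSeries (n : Fin g × Fin g →₀ ℕ) : (φ.torsionSeries N ζ a b).coeff n =
    ∑ᶠ x : {x // shiftExp m (N ^ 2) (fun i => (a i : ℚ) / N) x = n}, φ.torsionTerm N ζ a b x :=
  rfl

theorem map_torsionPhase (hN : N ≠ 0) (hζ : ι ((ζ : Op p) : Qpur p) = e ((1 : ℂ) / (N ^ 2 : ℕ)))
    {x : Matrix (Fin g) (Fin g) ℚ × (Fin g → ℚ)} (h : φ.coeff x.1 x.2 ≠ 0) :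
    ι ((torsionPhase m N ζ a b x : Op p) : Qpur p) =
      e ((fun i => (b i : ℂ) / N) ⬝ᵥ (fun i => (x.2 i : ℂ)) +
        m * ((fun i => (a i : ℂ) / N) ⬝ᵥ (fun i => (b i : ℂ) / N))) := by
  choose r hr using φ.exists_int_eq_snd h
  have h1 : (N : ℚ) * ∑ i, (b i : ℚ) * x.2 i + m * ∑ i, (a i : ℚ) * b i =
      ((N * ∑ i, b i * r i + m * ∑ i, a i * b i : ℤ) : ℚ) := by
    push_cast
    simp only [hr]
  rw [torsionPhase, h1, Int.floor_intCast]
  have h2 : ∀ n : ℤ, ι (((ζ ^ n : (Op p)ˣ) : Op p) : Qpur p) = e ((1 : ℂ) / (N ^ 2 : ℕ)) ^ n := by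
    intro n
    have h3 := Units.val_zpow_eq_zpow_val (Units.map (ι.comp (Op p).subtype).toMonoidHom ζ) n
    rw [← map_zpow] at h3
    rw [← hζ]
    exact h3
  rw [h2, ← e_intCast_mul]
  have hN' : (N : ℂ) ≠ 0 := by exact_mod_cast hN
  congr 1
  simp only [dotProduct, hr]
  push_cast
  simp only [add_mul, Finset.mul_sum, Finset.sum_mul]
  congr 1
  · exact Finset.sum_congr rfl fun i _ => by field_simp
  · exact Finset.sum_congr rfl fun i _ => by field_simp

theorem hasSum_torsionFun {τ : Matrix (Fin g) (Fin g) ℂ} (hτ : τ ∈ siegelH g) (hN : N ≠ 0)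
    (hζ : ι ((ζ : Op p) : Qpur p) = e ((1 : ℂ) / (N ^ 2 : ℕ))) :
    HasSum (fun x => ι (φ.torsionTerm N ζ a b x : Qpur p) *
        siegelChar (indexShift m (fun i => (a i : ℚ) / N) x).1 τ)
      (φ.torsionFun (fun i => (a i : ℂ) / N) (fun i => (b i : ℂ) / N) τ) := by
  set lam : Fin g → ℂ := fun i => (a i : ℂ) / N with hlam
  set mu : Fin g → ℂ := fun i => (b i : ℂ) / N with hmu
  refine ((φ.hasSum_jacobiChar hτ (lam ᵥ* τ + mu)).mul_left
    (e (m * ((lam ᵥ* τ) ⬝ᵥ lam + lam ⬝ᵥ mu)))).congr_fun fun x => ?_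
  by_cases h : φ.coeff x.1 x.2 = 0
  · simp [torsionTerm, h]
  have h1 := jacobiChar_indexShift m (fun i => (a i : ℚ) / N) x hτ.1 mu
  have h2 : (fun i => (((a i : ℚ) / N : ℚ) : ℂ)) = lam := by
    ext i; simp [hlam]
  simp only [h2] at h1
  have h3 : jacobiChar (indexShift m (fun i => (a i : ℚ) / N) x) τ mu =
      e (mu ⬝ᵥ (fun i => (x.2 i : ℂ)) + 2 * (m * (lam ⬝ᵥ mu))) *
        siegelChar (indexShift m (fun i => (a i : ℚ) / N) x).1 τ := by
    rw [jacobiChar, siegelChar, ← e_add, add_comm]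
    congr 2
    simp only [indexShift_snd_apply, dotProduct, hlam]
    push_cast
    rw [Finset.mul_sum, Finset.mul_sum, ← Finset.sum_add_distrib]
    exact Finset.sum_congr rfl fun i _ => by ring
  rw [torsionTerm]
  have h4 := map_torsionPhase (φ := φ) (a := a) (b := b) hN hζ h
  change ι ((φ.coeff x.1 x.2 : Qpur p) * ((torsionPhase m N ζ a b x : Op p) : Qpur p)) * _ = _
  rw [map_mul, h4, ← hlam, ← hmu, mul_left_comm, mul_assoc]
  congr 1
  rw [add_comm (lam ᵥ* τ) mu]
  symm
  have h5 := e_ne_zero (m * (lam ⬝ᵥ mu))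
  apply mul_left_cancel₀ h5
  calc _ = e (m * ((lam ᵥ* τ) ⬝ᵥ lam + 2 * (lam ⬝ᵥ mu))) * jacobiChar x τ (mu + lam ᵥ* τ) := by
        rw [← mul_assoc, ← e_add]
        congr 2
        ring
    _ = _ := by
        rw [← h1, h3, ← mul_assoc (e _) (e _), ← e_add]
        congr 2
        ring

theorem isExpansion_torsionSeries (hm : 1 ≤ m) (hN : N ≠ 0)
    (hζ : ι ((ζ : Op p) : Qpur p) = e ((1 : ℂ) / (N ^ 2 : ℕ))) :
    IsExpansion ι (N ^ 2) (φ.torsionSeries N ζ a b)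
      (φ.torsionFun (fun i => (a i : ℂ) / N) (fun i => (b i : ℂ) / N)) where
  supp n hn := by
    rw [coeff_torsionSeries] at hn
    obtain ⟨x, hx⟩ : ∃ x : {x // shiftExp m (N ^ 2) (fun i => (a i : ℚ) / N) x = n},
        φ.torsionTerm N ζ a b x ≠ 0 := by
      by_contra! h0
      exact hn (by simp [h0])
    have hc := left_ne_zero_of_mul hx
    rw [← x.2, expMatrix_of_coeff_ne_zero hm hN a hc]
    exact isIndex_of_coeff_ne_zero hm _ hc
  holo := φ.differentiableOn_torsionFun _ _
  hasSum Z hZ := by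
    have h1 := hasSum_torsionFun (φ := φ) (a := a) (b := b) hZ hN hζ
    rw [← (Equiv.sigmaFiberEquiv (shiftExp m (N ^ 2) (fun i => (a i : ℚ) / N))).hasSum_iff] at h1
    refine h1.sigma fun n => ?_
    have hfin := finite_support_torsionTerm (φ := φ) (ζ := ζ) (a := a) (b := b) hm hN n
    have h2 : HasSum (fun x : {x // shiftExp m (N ^ 2) (fun i => (a i : ℚ) / N) x = n} =>
        (ι.comp (Op p).subtype) (φ.torsionTerm N ζ a b x))
        ((ι.comp (Op p).subtype) ((φ.torsionSeries N ζ a b).coeff n)) := by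
      rw [coeff_torsionSeries, finsum_eq_sum _ hfin, map_sum]
      refine hasSum_sum_of_ne_finset_zero fun x hx => ?_
      have : φ.torsionTerm N ζ a b x = 0 := by
        by_contra h0
        exact hx (hfin.mem_toFinset.mpr h0)
      rw [this, map_zero]
    refine (h2.mul_right (siegelChar (expMatrix (N ^ 2) n) Z)).congr_fun fun x => ?_
    change ι (φ.torsionTerm N ζ a b x : Qpur p) * _ = ι (φ.torsionTerm N ζ a b x : Qpur p) * _
    by_cases h : φ.torsionTerm N ζ a b x = 0
    · simp [h]
    · congr 1
      change siegelChar (indexShift m (fun i => (a i : ℚ) / N) x.1).1 Z = _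
      rw [← expMatrix_of_coeff_ne_zero hm hN a (left_ne_zero_of_mul h), x.2]

/-- Restriction to a torsion point lowers the diagonal vanishing order by at most `m / 4`: an
integral translation leads from any Fourier index to one with `|R_i| ≤ m`, whose diagonal entries
exceed those of `T - R Rᵗ / (4 m)` by at most `m / 4`. -/
theorem coeff_torsionSeries_mem (hm : 1 ≤ m) (hN : N ≠ 0) {l : ℕ}
    (hl : ∀ (T : Matrix (Fin g) (Fin g) ℚ) (R : Fin g → ℚ),
      (∀ i, T i i ≤ l) → φ.coeff T R ∈ primeP p) {n : Fin g × Fin g →₀ ℕ}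
    (hn : ∀ i, n (i, i) + N ^ 2 * m ≤ 4 * N ^ 2 * l) :
    (φ.torsionSeries N ζ a b).coeff n ∈ primeP p := by
  rw [coeff_torsionSeries]
  refine finsum_induction (· ∈ primeP p) (zero_mem _) (fun _ _ => add_mem) fun x => ?_
  refine Ideal.mul_mem_right _ _ ?_
  by_cases hc : φ.coeff x.1.1 x.1.2 = 0
  · rw [hc]; exact zero_mem _
  have hm' : (0 : ℚ) < m := by exact_mod_cast hm
  let lam' : Fin g → ℤ := fun i => -round (x.1.2 i / (2 * m))
  rw [← φ.coeff_indexShift lam']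
  refine hl _ _ fun i => ?_
  have h1 := expMatrix_diag (pow_ne_zero 2 hN) n i
  have hexp := expMatrix_of_coeff_ne_zero hm hN a hc
  rw [x.2] at hexp
  rw [hexp] at h1
  have h2 := indexShift_invariant m (fun i => (a i : ℚ) / N) x.1 i i
  have h3 := indexShift_invariant m (fun i => (lam' i : ℚ)) x.1 i i
  have h4 : |(indexShift m (fun i => (lam' i : ℚ)) x.1).2 i| ≤ m := by
    have h5 := abs_sub_round (x.1.2 i / (2 * m))
    have h6 : (indexShift m (fun i => (lam' i : ℚ)) x.1).2 i =
        2 * m * (x.1.2 i / (2 * m) - round (x.1.2 i / (2 * m))) := by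
      rw [indexShift_snd_apply]
      simp only [lam']
      push_cast
      field_simp
      ring
    rw [h6, abs_mul, abs_of_pos (by positivity)]
    nlinarith
  have h7 : (n (i, i) : ℚ) + (N ^ 2 : ℕ) * m ≤ 4 * (N ^ 2 : ℕ) * l := by exact_mod_cast hn i
  have hQ : (0 : ℚ) < (N ^ 2 : ℕ) := by exact_mod_cast Nat.pos_of_ne_zero (pow_ne_zero 2 hN)
  rw [h1] at h7
  have h8 : 4 * (indexShift m (fun i => (a i : ℚ) / N) x.1).1 i i + m ≤ 4 * l := by
    by_contra h9
    push Not at h9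
    nlinarith
  have h10 := (sq_le_sq₀ (abs_nonneg _) hm'.le).mpr h4
  rw [sq_abs] at h10
  have h11 := mul_self_nonneg ((indexShift m (fun i => (a i : ℚ) / N) x.1).2 i)
  have h12 : 4 * m * (indexShift m (fun i => (lam' i : ℚ)) x.1).1 i i ≤ m * (4 * l) := by
    nlinarith
  have h13 : m * (4 * (indexShift m (fun i => (lam' i : ℚ)) x.1).1 i i) ≤ m * (4 * (l : ℚ)) := by
    linarith
  linarith [le_of_mul_le_mul_left h13 hm']

end JacobiForm

end TorsionSeries

/-! ### The action of the symplectic group on torsion points -/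

section Permutation

open Matrix

variable {g : ℕ} {p : ℕ} [Fact p.Prime] {ι : Qpur p →+* ℂ} {k m : ℕ}

theorem IsExpansion.smul {Q : ℕ} {f : MvPowerSeries (Fin g × Fin g) (Op p)}
    {Φ : Matrix (Fin g) (Fin g) ℂ → ℂ} (h : IsExpansion ι Q f Φ) (c : Op p) :
    IsExpansion ι Q (c • f) (fun Z => ι (c : Qpur p) * Φ Z) where
  supp n hn := h.supp n fun h0 => hn (by rw [MvPowerSeries.coeff_smul, h0, mul_zero])
  holo := DifferentiableOn.const_mul (E := Fin g → Fin g → ℂ) h.holo _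
  hasSum Z hZ := by
    refine ((h.hasSum Z hZ).mul_left (ι (c : Qpur p))).congr_fun fun n => ?_
    rw [MvPowerSeries.coeff_smul, ← mul_assoc, ← map_mul]
    rfl

/-- Elementary symmetric functions of a finite family of functions that is permuted by the
symplectic group, up to the automorphy factor of weight `k`, are modular forms. -/
theorem esymm_mem_formSeries {I : Type*} [Fintype I] {Q : ℕ}
    {F : I → MvPowerSeries (Fin g × Fin g) (Op p)} {Φ : I → Matrix (Fin g) (Fin g) ℂ → ℂ}
    (hF : ∀ i, IsExpansion ι Q (F i) (Φ i))
    (hΦ : ∀ M ∈ symplecticGroup (Fin g) ℤ, ∃ π : Equiv.Perm I, ∀ Z ∈ siegelH g, ∀ i,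
      Φ i (moebius M Z) = (denom M Z).det ^ k * Φ (π i) Z) (j : ℕ) :
    ∑ t ∈ (Finset.univ : Finset I).powersetCard j, ∏ i ∈ t, F i ∈ formSeries g ι Q (k * j) := by
  refine ⟨∑ t ∈ (Finset.univ : Finset I).powersetCard j, ∏ i ∈ t, Φ i,
    .sum _ fun t _ => .prod _ fun i _ => hF i, fun M hM Z hZ => ?_⟩
  obtain ⟨π, hπ⟩ := hΦ M hM
  simp only [Finset.sum_apply, Finset.prod_apply, Finset.mul_sum]
  refine Finset.sum_equiv (Equiv.finsetCongr π) (fun t => by simp) fun t ht => ?_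
  rw [Equiv.finsetCongr_apply, Finset.prod_map, Finset.prod_congr rfl fun i _ => hπ Z hZ i,
    Finset.prod_mul_distrib, Finset.prod_const, (Finset.mem_powersetCard.mp ht).2, ← pow_mul]
  rfl

/-- Integral representatives of a vector over `ℤ/N`. -/
def zmodRep {N : ℕ} (x : Fin g → ZMod N) : Fin g → ℤ := fun i => (x i).val

theorem e_zmod_add_int {Q : ℕ} [NeZero Q] (u : ZMod Q) (s : ℤ) :
    e (((u + (s : ZMod Q)).val : ℂ) / Q) = e ((u.val : ℂ) / Q) * e ((s : ℂ) / Q) := by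
  have hQ : (Q : ℂ) ≠ 0 := by exact_mod_cast NeZero.ne Q
  have h1 : (((u.val + s : ℤ)) : ZMod Q) = (((u + (s : ZMod Q)).val : ℤ) : ZMod Q) := by
    push_cast
    simp
  obtain ⟨c, hc⟩ := (ZMod.intCast_eq_intCast_iff_dvd_sub _ _ _).mp h1
  have h2 : ((u + (s : ZMod Q)).val : ℂ) = u.val + s + Q * c := by
    have : (((u + (s : ZMod Q)).val : ℤ) : ℂ) = ((u.val + s + Q * c : ℤ) : ℂ) := by
      rw [← hc]; congr 1; ring
    push_cast at this
    exact this
  rw [h2, ← e_add, show ((u.val : ℂ) + s + Q * c) / Q = u.val / Q + s / Q + (c : ℤ) by field_simp,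
    e_add _ (c : ℂ), e_intCast, mul_one]

namespace JacobiForm

variable (φ : JacobiForm p ι g k m)

/-- The restrictions of a Jacobi form to all `N`-torsion points, times all roots of unity of order
dividing `N²`. -/
def torsionFamily (N : ℕ) (i : ZMod (N ^ 2) × (Fin g ⊕ Fin g → ZMod N)) :
    Matrix (Fin g) (Fin g) ℂ → ℂ := fun τ =>
  e ((i.1.val : ℂ) / (N ^ 2 : ℕ)) *
    φ.torsionFun (fun j => (zmodRep (fun l => i.2 (.inl l)) j : ℂ) / N)
      (fun j => (zmodRep (fun l => i.2 (.inr l)) j : ℂ) / N) τ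

/-- The symplectic group permutes the restrictions to torsion points up to roots of unity, hence
permutes `torsionFamily`. -/
theorem exists_perm_torsionFamily (N : ℕ) [NeZero N]
    {M : Matrix (Fin g ⊕ Fin g) (Fin g ⊕ Fin g) ℤ} (hM : M ∈ symplecticGroup (Fin g) ℤ) :
    ∃ π : Equiv.Perm (ZMod (N ^ 2) × (Fin g ⊕ Fin g → ZMod N)), ∀ Z ∈ siegelH g, ∀ i,
      φ.torsionFamily N i (moebius M Z) = (denom M Z).det ^ k * φ.torsionFamily N (π i) Z := by
  have hN : (N : ℂ) ≠ 0 := by exact_mod_cast NeZero.ne N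
  let MN : Matrix (Fin g ⊕ Fin g) (Fin g ⊕ Fin g) (ZMod N) := M.map (Int.castRingHom (ZMod N))
  have hMN : IsUnit MN.det := SymplecticGroup.symplectic_det (SymplecticGroup.map_mem hM _)
  -- Write the translated integral vector as the representative of its residue class plus `N * γ`.
  let rep : (Fin g ⊕ Fin g → ZMod N) → Fin g ⊕ Fin g → ℤ := fun x j => (x j).val
  have hrep : ∀ x, ∃ γ : Fin g ⊕ Fin g → ℤ, rep x ᵥ* M = rep (x ᵥ* MN) + fun j => N * γ j := by
    intro x
    have h1 : ∀ j, ∃ c : ℤ, (rep x ᵥ* M) j = rep (x ᵥ* MN) j + N * c := by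
      intro j
      have h2 : ((rep (x ᵥ* MN) j : ℤ) : ZMod N) = (((rep x ᵥ* M) j : ℤ) : ZMod N) := by
        simp [rep, vecMul, dotProduct, MN]
      obtain ⟨c, hc⟩ := (ZMod.intCast_eq_intCast_iff_dvd_sub _ _ _).mp h2
      exact ⟨c, by rw [← hc]; ring⟩
    choose γ hγ using h1
    exact ⟨γ, funext hγ⟩
  choose γ hγ using hrep
  let s : (Fin g ⊕ Fin g → ZMod N) → ℤ := fun x => N * (m *
    (∑ j, rep (x ᵥ* MN) (.inl j) * γ x (.inr j) - ∑ j, γ x (.inl j) * rep (x ᵥ* MN) (.inr j)))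
  let f : ZMod (N ^ 2) × (Fin g ⊕ Fin g → ZMod N) → ZMod (N ^ 2) × (Fin g ⊕ Fin g → ZMod N) :=
    fun i => (i.1 + (s i.2 : ZMod (N ^ 2)), i.2 ᵥ* MN)
  have hf : Function.Injective f := by
    rintro ⟨u, x⟩ ⟨u', x'⟩ h
    obtain ⟨h1, h2⟩ := Prod.mk.inj h
    have hx : x = x' := by
      have h3 := congrArg (· ᵥ* MN⁻¹) h2
      simpa only [vecMul_vecMul, mul_nonsing_inv _ hMN, vecMul_one] using h3
    subst hx
    exact Prod.ext (add_right_cancel h1) rfl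
  refine ⟨Equiv.ofBijective f (Finite.injective_iff_bijective.mp hf), ?_⟩
  rintro Z hZ ⟨u, x⟩
  rw [torsionFamily, torsionFamily, φ.torsionFun_moebius hM hZ]
  have hcomp : ∀ j, ((rep x ᵥ* M) j : ℂ) = rep (x ᵥ* MN) j + N * γ x j := fun j => by
    rw [hγ x]; push_cast [Pi.add_apply]; rfl
  have hv1 : (fun j => (zmodRep (fun l => x (.inl l)) j : ℂ) / N) ᵥ*
        M.toBlocks₁₁.map (Int.cast : ℤ → ℂ) +
      (fun j => (zmodRep (fun l => x (.inr l)) j : ℂ) / N) ᵥ*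
        M.toBlocks₂₁.map (Int.cast : ℤ → ℂ) =
      (fun j => (rep (x ᵥ* MN) (.inl j) : ℂ) / N) + fun j => (γ x (.inl j) : ℂ) := by
    ext j
    have h1 := hcomp (.inl j)
    simp only [vecMul, dotProduct, Fintype.sum_sum_type] at h1
    simp only [Pi.add_apply, vecMul, dotProduct, map_apply, toBlocks₁₁, toBlocks₂₁, of_apply,
      zmodRep]
    push_cast at h1
    simp only [rep] at h1 ⊢
    push_cast at h1 ⊢
    simp only [div_mul_eq_mul_div, ← Finset.sum_div]
    rw [← add_div, h1]
    field_simp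
  have hv2 : (fun j => (zmodRep (fun l => x (.inl l)) j : ℂ) / N) ᵥ*
        M.toBlocks₁₂.map (Int.cast : ℤ → ℂ) +
      (fun j => (zmodRep (fun l => x (.inr l)) j : ℂ) / N) ᵥ*
        M.toBlocks₂₂.map (Int.cast : ℤ → ℂ) =
      (fun j => (rep (x ᵥ* MN) (.inr j) : ℂ) / N) + fun j => (γ x (.inr j) : ℂ) := by
    ext j
    have h1 := hcomp (.inr j)
    simp only [vecMul, dotProduct, Fintype.sum_sum_type] at h1
    simp only [Pi.add_apply, vecMul, dotProduct, map_apply, toBlocks₁₂, toBlocks₂₂, of_apply,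
      zmodRep]
    push_cast at h1
    simp only [rep] at h1 ⊢
    push_cast at h1 ⊢
    simp only [div_mul_eq_mul_div, ← Finset.sum_div]
    rw [← add_div, h1]
    field_simp
  rw [hv1, hv2, φ.torsionFun_add_int hZ]
  have hs : e (m * ((fun j => (rep (x ᵥ* MN) (.inl j) : ℂ) / N) ⬝ᵥ
        (fun j => (γ x (.inr j) : ℂ)) - (fun j => (γ x (.inl j) : ℂ)) ⬝ᵥ
        (fun j => (rep (x ᵥ* MN) (.inr j) : ℂ) / N))) = e ((s x : ℂ) / (N ^ 2 : ℕ)) := by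
    congr 1
    simp only [s, dotProduct]
    push_cast
    simp only [div_mul_eq_mul_div, mul_div_assoc', ← Finset.sum_div]
    field_simp
  rw [hs, mul_left_comm, ← mul_assoc (e ((u.val : ℂ) / _)), ← e_zmod_add_int]
  rfl

end JacobiForm

end Permutation

/-! ### Vanishing of the restrictions to torsion points -/

section Vanishing

open Matrix

variable {g : ℕ} {p : ℕ} [Fact p.Prime] {ι : Qpur p →+* ℂ} {k m : ℕ}

theorem mem_span_X_pow_iff {σ κ R : Type*} [Finite κ] [CommRing R] (s : κ → σ) (L : ℕ)
    (f : MvPowerSeries σ R) :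
    f ∈ Ideal.span (Set.range fun i => (MvPowerSeries.X (s i) : MvPowerSeries σ R) ^ L) ↔
      ∀ n : σ →₀ ℕ, (∀ i, n (s i) < L) → f.coeff n = 0 := by
  classical
  have := Fintype.ofFinite κ
  refine ⟨fun hf n hn => ?_, fun hf => ?_⟩
  · obtain ⟨c, rfl⟩ := Ideal.mem_span_range_iff_exists_fun.mp hf
    rw [map_sum]
    exact Finset.sum_eq_zero fun i _ =>
      MvPowerSeries.X_pow_dvd_iff.mp (dvd_mul_left _ (c i)) n (hn i)
  · -- Every exponent that occurs is assigned to some variable of exponent at least `L`.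
    let c : (σ →₀ ℕ) → Option κ := fun n => if h : ∃ i, L ≤ n (s i) then some h.choose else none
    have hc : ∀ n i, c n = some i → L ≤ n (s i) := by
      intro n i h
      by_cases h' : ∃ i, L ≤ n (s i)
      · simp only [c, dif_pos h', Option.some.injEq] at h
        exact h ▸ h'.choose_spec
      · simp [c, dif_neg h'] at h
    let F : κ → MvPowerSeries σ R := fun i n => if c n = some i then f.coeff n else 0
    have hsum : f = ∑ i, F i := by
      ext n
      rw [map_sum]
      change f.coeff n = ∑ i, if c n = some i then f.coeff n else 0
      rcases h : c n with _ | i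
      · have : ∀ i, n (s i) < L := by
          by_contra! h'
          simp [c, dif_pos h'] at h
        simp [hf n this]
      · simp
    rw [hsum]
    refine Ideal.sum_mem _ fun i _ => Ideal.mem_of_dvd _ (a := (MvPowerSeries.X (s i)) ^ L) ?_
      (Ideal.subset_span ⟨i, rfl⟩)
    refine MvPowerSeries.X_pow_dvd_iff.mpr fun n hn => ?_
    change (if c n = some i then f.coeff n else 0) = 0
    rw [if_neg fun h => absurd (hc n i h) (not_le.mpr hn)]

theorem natCast_mem_primeP : (p : Op p) ∈ primeP p := by
  rw [primeP, IsLocalRing.mem_maximalIdeal, mem_nonunits_iff]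
  intro hu
  obtain ⟨b, hb⟩ := hu.exists_right_inv
  have hvb : Valued.v (algebraMap (Qpur p) (PadicAlgCl p) b) ≤ 1 := b.2
  have h1 := congrArg (fun x : Op p => Valued.v (algebraMap (Qpur p) (PadicAlgCl p) x)) hb
  have h2 : Valued.v (p : PadicAlgCl p) * Valued.v (algebraMap (Qpur p) (PadicAlgCl p) b) = 1 := by
    rw [← map_mul]
    simpa using h1
  rw [PadicAlgCl.valuation_p] at h2
  have hp1 : (1 : NNReal) < p := by exact_mod_cast (Fact.out : p.Prime).one_lt
  have h3 : 1 / (p : NNReal) < 1 := by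
    rw [div_lt_one (zero_lt_one.trans hp1)]
    exact hp1
  have h4 : 1 / (p : NNReal) * Valued.v (algebraMap (Qpur p) (PadicAlgCl p) b) < 1 :=
    lt_of_le_of_lt (mul_le_of_le_one_right zero_le hvb) h3
  exact h4.ne h2

/-- The residue field of `O_𝔭`. -/
abbrev resField (p : ℕ) [Fact p.Prime] : Type := IsLocalRing.ResidueField (Op p)

instance : CharP (resField p) p := by
  refine (CharP.charP_iff_prime_eq_zero Fact.out).mpr ?_
  rw [← map_natCast (IsLocalRing.residue (Op p)), IsLocalRing.residue_eq_zero_iff]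
  exact natCast_mem_primeP

instance : CharP (MvPowerSeries (Fin g × Fin g) (resField p)) p :=
  charP_of_injective_ringHom (f := MvPowerSeries.C (σ := Fin g × Fin g) (R := resField p))
    MvPowerSeries.C_injective p

instance : IsDomain (MvPowerSeries (Fin g × Fin g) (resField p)) := NoZeroDivisors.to_isDomain _

theorem coeff_map_residue_eq_zero {f : MvPowerSeries (Fin g × Fin g) (Op p)}
    {n : Fin g × Fin g →₀ ℕ} :
    (MvPowerSeries.map (IsLocalRing.residue (Op p)) f).coeff n = 0 ↔ f.coeff n ∈ primeP p := by
  rw [MvPowerSeries.coeff_map, IsLocalRing.residue_eq_zero_iff]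
  rfl

/-- The slope hypothesis in terms of real numbers. -/
theorem exists_real_slope {ρ : ℝ≥0∞} (hρ : 0 < ρ) {l : ℕ}
    (h : (m : ℝ≥0∞) / 4 + (k : ℝ≥0∞) / ρ < l) :
    ∃ r : ℝ, 0 < r ∧ ENNReal.ofReal r ≤ ρ ∧ (m : ℝ) / 4 + k / r < l := by
  rcases eq_or_ne ρ ⊤ with rfl | htop
  · rw [ENNReal.div_top, add_zero] at h
    have h1 := (ENNReal.toReal_lt_toReal h.ne_top (ENNReal.natCast_ne_top l)).mpr h
    simp only [ENNReal.toReal_div, ENNReal.toReal_natCast, ENNReal.toReal_ofNat] at h1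
    have h2 : (m : ℝ) + 1 ≤ 4 * l := by
      have : (m : ℝ) < 4 * l := by linarith
      exact_mod_cast this
    refine ⟨4 * k + 1, by positivity, le_top, ?_⟩
    have h3 : (k : ℝ) / (4 * k + 1) < 1 / 4 := by
      rw [div_lt_div_iff₀ (by positivity) (by norm_num)]
      linarith
    linarith
  · have hpos := ENNReal.toReal_pos hρ.ne' htop
    refine ⟨ρ.toReal, hpos, (ENNReal.ofReal_toReal htop).le, ?_⟩
    have h1 := (ENNReal.toReal_lt_toReal h.ne_top (ENNReal.natCast_ne_top l)).mpr h
    rw [ENNReal.toReal_add (by finiteness) (ENNReal.div_ne_top (by simp) hρ.ne')] at h1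
    simpa using h1

/-- For large `q = p ^ u` the slope bound forces forms of weight `k * P * (q + j)` with `j < r` to
vanish modulo `𝔭` if their order exceeds `P * q * (l - m / 4)`; an additive constant lost in rounding
is absorbed by `q`. -/
theorem exists_slope_exponent {ρ : ℝ≥0∞} (hρ : 0 < ρ) {l : ℕ}
    (h : (m : ℝ≥0∞) / 4 + (k : ℝ≥0∞) / ρ < l) (P r : ℕ) (hP : 0 < P) :
    ∃ u : ℕ, ∀ j < r, ((k * P * (p ^ u + j) : ℕ) : ℝ≥0∞) <
      ρ * (P * p ^ u * (4 * l - m) / 4 : ℕ) := by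
  obtain ⟨s, hs, hsρ, hlt⟩ := exists_real_slope hρ h
  have hml : m ≤ 4 * l := by
    have h1 : (0 : ℝ) ≤ k / s := by positivity
    have h2 : (m : ℝ) ≤ 4 * l := by linarith
    exact_mod_cast h2
  have hδ : 0 < s * ((4 * l - m) / 4) - k := by
    have h1 : (k : ℝ) / s < (4 * l - m) / 4 := by linarith
    rw [div_lt_iff₀ hs] at h1
    linarith
  set δ := s * (((4 : ℝ) * l - m) / 4) - k with hδdef
  have hp1 : 1 < p := (Fact.out : p.Prime).one_lt
  obtain ⟨u, hu⟩ := pow_unbounded_of_one_lt ((k * P * r + s) / (P * δ))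
    (show (1 : ℝ) < p by exact_mod_cast hp1)
  refine ⟨u, fun j hj => ?_⟩
  have hP' : (0 : ℝ) < P := by exact_mod_cast hP
  rw [div_lt_iff₀ (by positivity)] at hu
  have hfloor : (P * p ^ u * (4 * l - m) : ℝ) / 4 < (P * p ^ u * (4 * l - m) / 4 : ℕ) + 1 := by
    have h1 := Nat.lt_div_mul_add (a := P * p ^ u * (4 * l - m)) (b := 4) (by norm_num)
    have h2 : ((P * p ^ u * (4 * l - m) : ℕ) : ℝ) <
        (P * p ^ u * (4 * l - m) / 4 : ℕ) * 4 + 4 := by exact_mod_cast h1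
    push_cast [Nat.cast_sub hml] at h2 ⊢
    linarith
  have hj' : (k : ℝ) * P * j ≤ k * P * r := by gcongr
  have hreal : ((k * P * (p ^ u + j) : ℕ) : ℝ) < s * (P * p ^ u * (4 * l - m) / 4 : ℕ) := by
    have h3 := mul_lt_mul_of_pos_left hfloor hs
    push_cast at h3 ⊢
    rw [hδdef] at hu
    nlinarith
  calc ((k * P * (p ^ u + j) : ℕ) : ℝ≥0∞)
      = ENNReal.ofReal ((k * P * (p ^ u + j) : ℕ) : ℝ) := (ENNReal.ofReal_natCast _).symm
    _ < ENNReal.ofReal (s * (P * p ^ u * (4 * l - m) / 4 : ℕ)) :=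
        (ENNReal.ofReal_lt_ofReal_iff_of_nonneg (Nat.cast_nonneg _)).mpr hreal
    _ = ENNReal.ofReal s * (P * p ^ u * (4 * l - m) / 4 : ℕ) := by
        rw [ENNReal.ofReal_mul hs.le, ENNReal.ofReal_natCast]
    _ ≤ _ := by gcongr

/-- If the order of `φ` exceeds the bound, all restrictions of `φ` to torsion points vanish modulo
`𝔭`. -/
theorem JacobiForm.coeff_torsionSeries_mem_of_slope (φ : JacobiForm p ι g k m) (hk : 1 ≤ k)
    (hm : 1 ≤ m) {l : ℕ}
    (hl : ∀ (T : Matrix (Fin g) (Fin g) ℚ) (R : Fin g → ℚ),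
      (∀ i, T i i ≤ l) → φ.coeff T R ∈ primeP p)
    (hρ : 0 < diagSlopeBound p ι g)
    (hlt : (m : ℝ≥0∞) / 4 + (k : ℝ≥0∞) / diagSlopeBound p ι g < l) {N : ℕ} (hN : N ≠ 0)
    {ζ : (Op p)ˣ} (hζ : ι ((ζ : Op p) : Qpur p) = e ((1 : ℂ) / (N ^ 2 : ℕ)))
    (x : Fin g ⊕ Fin g → ZMod N) (n : Fin g × Fin g →₀ ℕ) :
    (φ.torsionSeries N ζ (zmodRep fun i => x (.inl i)) (zmodRep fun i => x (.inr i))).coeff n ∈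
      primeP p := by
  have : NeZero N := ⟨hN⟩
  have hp : p.Prime := Fact.out
  have hQ : N ^ 2 ≠ 0 := pow_ne_zero 2 hN
  have hml : m ≤ 4 * l := by
    obtain ⟨s, hs, -, hlt'⟩ := exists_real_slope hρ hlt
    have h1 : (0 : ℝ) ≤ k / s := by positivity
    have h2 : (m : ℝ) ≤ 4 * l := by linarith
    exact_mod_cast h2
  let F : ZMod (N ^ 2) × (Fin g ⊕ Fin g → ZMod N) → MvPowerSeries (Fin g × Fin g) (Op p) :=
    fun i => ((ζ : Op p) ^ i.1.val) • φ.torsionSeries N ζ (zmodRep fun j => i.2 (.inl j))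
      (zmodRep fun j => i.2 (.inr j))
  have hF : ∀ i, IsExpansion ι (N ^ 2) (F i) (φ.torsionFamily N i) := by
    intro i
    have h1 := (isExpansion_torsionSeries (φ := φ) (a := zmodRep fun j => i.2 (.inl j))
      (b := zmodRep fun j => i.2 (.inr j)) hm hN hζ).smul ((ζ : Op p) ^ i.1.val)
    have h2 : ι (((ζ : Op p) ^ i.1.val : Op p) : Qpur p) = e ((i.1.val : ℂ) / (N ^ 2 : ℕ)) := by
      push_cast
      rw [map_pow, hζ, ← e_natCast_mul]
      congr 1
      push_cast
      ring
    rw [h2] at h1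
    exact h1
  let L := N ^ 2 * (4 * l - m) + 1
  have hzero := map_eq_zero_of_esymm_mem p (formSeries g ι (N ^ 2))
    (MvPowerSeries.map (σ := Fin g × Fin g) (IsLocalRing.residue (Op p))) k L
    (fun i : Fin g => MvPowerSeries.X (i, i)) F
    (esymm_mem_formSeries (Φ := φ.torsionFamily N) hF fun M hM => φ.exists_perm_torsionFamily N hM)
    (fun i => ?_) (fun a r => ?_) (0, x)
  · have h1 := congrArg (fun f => f.coeff n) hzero
    simp only [F, ZMod.val_zero, pow_zero, one_smul] at h1
    exact coeff_map_residue_eq_zero.mp h1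
  · refine (mem_span_X_pow_iff (fun i : Fin g => (i, i)) L _).mpr fun n hn => ?_
    rw [coeff_map_residue_eq_zero, MvPowerSeries.coeff_smul]
    refine Ideal.mul_mem_left _ _ (coeff_torsionSeries_mem hm hN hl fun i => ?_)
    have h1 : n (i, i) ≤ N ^ 2 * (4 * l - m) := Nat.lt_succ_iff.mp (hn i)
    calc n (i, i) + N ^ 2 * m ≤ N ^ 2 * (4 * l - m) + N ^ 2 * m := by gcongr
      _ = 4 * N ^ 2 * l := by rw [← mul_add, Nat.sub_add_cancel hml]; ring
  · obtain ⟨u, hu⟩ := exists_slope_exponent (p := p) hρ hlt (p ^ a) r (pow_pos hp.pos a)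
    refine ⟨u, fun j hj h hM hJ => ?_⟩
    rw [mem_span_X_pow_iff (fun i : Fin g => (i, i))] at hJ
    ext n
    rw [map_zero, coeff_map_residue_eq_zero]
    refine coeff_mem_of_slope hQ ?_ hM (p ^ a * p ^ u * (4 * l - m) / 4) (fun n hn => ?_)
      (hu j hj) n
    · have := pow_pos hp.pos a
      have := pow_pos hp.pos u
      exact Nat.mul_pos (Nat.mul_pos hk ‹_›) (by omega)
    · refine coeff_map_residue_eq_zero.mp (hJ n fun i => ?_)
      have hpos : 0 < p ^ a * p ^ u := Nat.mul_pos (pow_pos hp.pos a) (pow_pos hp.pos u)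
      calc n (i, i) ≤ 4 * N ^ 2 * (p ^ a * p ^ u * (4 * l - m) / 4) := hn i
        _ = N ^ 2 * (p ^ a * p ^ u * (4 * l - m) / 4 * 4) := by ring
        _ ≤ N ^ 2 * (p ^ a * p ^ u * (4 * l - m)) :=
            Nat.mul_le_mul_left _ (Nat.div_mul_le_self _ _)
        _ = N ^ 2 * (4 * l - m) * (p ^ a * p ^ u) := by ring
        _ < L * (p ^ a * p ^ u) := Nat.mul_lt_mul_of_pos_right (Nat.lt_succ_self _) hpos

/-! ### Recovering the Fourier coefficients from the torsion points -/

/-- Orthogonality of the characters of `(ℤ/N)^g`. -/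
theorem sum_prod_pow_eq_zero {R : Type*} [CommRing R] [IsDomain R] {N : ℕ} [NeZero N]
    (w : Fin g → R) (hw : ∀ i, w i ^ N = 1) (hne : ∃ i, w i ≠ 1) :
    ∑ b : Fin g → ZMod N, ∏ i, w i ^ (b i).val = 0 := by
  classical
  obtain ⟨i, hi⟩ := hne
  have h1 := Finset.sum_prod_piFinset (Finset.univ : Finset (ZMod N))
    (fun i (c : ZMod N) => w i ^ c.val)
  rw [Fintype.piFinset_univ] at h1
  rw [h1]
  refine Finset.prod_eq_zero (Finset.mem_univ i) ?_
  have h2 : ∑ c : ZMod N, w i ^ c.val = ∑ j ∈ Finset.range N, w i ^ j := by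
    refine Finset.sum_bij (fun c _ => c.val) (fun c _ => by simpa using ZMod.val_lt c)
      (fun c _ c' _ h => ZMod.val_injective N h) (fun j hj => ⟨(j : ZMod N), Finset.mem_univ _, ?_⟩)
      (fun _ _ => rfl)
    exact ZMod.val_cast_of_lt (Finset.mem_range.mp hj)
  rw [h2]
  have h3 := geom_sum_mul (w i) N
  rw [hw, sub_self] at h3
  exact (mul_eq_zero.mp h3).resolve_right (sub_ne_zero.mpr hi)

theorem zpow_finset_sum {α G : Type*} [CommGroup G] (x : G) (s : Finset α) (f : α → ℤ) :
    x ^ (∑ i ∈ s, f i) = ∏ i ∈ s, x ^ f i := by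
  classical
  induction s using Finset.induction_on with
  | empty => simp
  | insert a s ha ih => rw [Finset.sum_insert ha, Finset.prod_insert ha, _root_.zpow_add, ih]

/-- If the restrictions to all points `z = b / N` vanish modulo `𝔭`, where `N` is prime to `p` and
large compared to `T`, then the coefficients of index `(T, R)` vanish modulo `𝔭`: these restrictions
determine the sums of the coefficients over the residue classes of `R` modulo `N`, which contain at
most one nonzero term. -/
theorem JacobiForm.coeff_mem_of_torsionSeries (φ : JacobiForm p ι g k m) (hm : 1 ≤ m) {N : ℕ}
    (hN : N ≠ 0) {ζ : (Op p)ˣ} (hζ : IsPrimitiveRoot ζ (N ^ 2)) (hNp : (N : Op p) ∉ primeP p)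
    (h : ∀ (b : Fin g → ZMod N) n, (φ.torsionSeries N ζ 0 (zmodRep b)).coeff n ∈ primeP p)
    (T : Matrix (Fin g) (Fin g) ℚ) (R : Fin g → ℚ)
    (hT : ∀ i, 2 * (4 * m * |T i i| + 1) < N) : φ.coeff T R ∈ primeP p := by
  classical
  have : NeZero N := ⟨hN⟩
  by_cases hTR : φ.coeff T R = 0
  · rw [hTR]; exact zero_mem _
  let lam : Fin g → ℚ := fun i => ((0 : Fin g → ℤ) i : ℚ) / N
  have hlam : lam = 0 := by ext; simp [lam]
  have hshift : ∀ x, indexShift m lam x = x := by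
    intro x
    rw [hlam]
    refine Prod.ext (Matrix.ext fun i j => ?_) (funext fun i => ?_)
    · simp [indexShift_fst_apply]
    · simp [indexShift_snd_apply]
  let n := shiftExp m (N ^ 2) lam (T, R)
  have hexp : ∀ x : Matrix (Fin g) (Fin g) ℚ × (Fin g → ℚ), φ.coeff x.1 x.2 ≠ 0 →
      expMatrix (N ^ 2) (shiftExp m (N ^ 2) lam x) = x.1 := by
    intro x hx
    have := expMatrix_of_coeff_ne_zero hm hN 0 hx
    rwa [show (fun i => ((0 : Fin g → ℤ) i : ℚ) / N) = lam from rfl, hshift] at this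
  have hfin := finite_fiber (φ := φ) (a := 0) hm hN n
  let X := hfin.toFinset
  have hX : ∀ x, x ∈ X ↔ shiftExp m (N ^ 2) lam x = n ∧ φ.coeff x.1 x.2 ≠ 0 := fun x =>
    hfin.mem_toFinset
  have hXT : ∀ x ∈ X, x.1 = T := by
    intro x hx
    obtain ⟨h1, h2⟩ := (hX x).mp hx
    rw [← hexp x h2, h1, hexp (T, R) hTR]
  let η : (Op p)ˣ := ζ ^ N
  have hη : IsPrimitiveRoot η N := hζ.pow (Nat.pos_of_ne_zero (pow_ne_zero 2 hN)) (sq N)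
  have hexists : ∀ x : Matrix (Fin g) (Fin g) ℚ × (Fin g → ℚ), ∃ r : Fin g → ℤ,
      φ.coeff x.1 x.2 ≠ 0 → ∀ i, x.2 i = r i := by
    intro x
    by_cases hx : φ.coeff x.1 x.2 = 0
    · exact ⟨0, fun h => absurd hx h⟩
    · choose r hr using φ.exists_int_eq_snd hx
      exact ⟨r, fun _ => hr⟩
  choose r hr using hexists
  have hcoeff : ∀ b : Fin g → ZMod N, (φ.torsionSeries N ζ 0 (zmodRep b)).coeff n =
      ∑ x ∈ X, φ.coeff x.1 x.2 * ((∏ i, (η ^ r x i) ^ (b i).val : (Op p)ˣ) : Op p) := by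
    intro b
    rw [coeff_torsionSeries,
      finsum_subtype_eq_finsum_cond (f := fun x => φ.torsionTerm N ζ 0 (zmodRep b) x),
      finsum_cond_eq_sum_of_cond_iff (t := X) _ fun {x} hx => ?_]
    · refine Finset.sum_congr rfl fun x hx => ?_
      rw [torsionTerm, torsionPhase]
      congr 2
      have h1 : (N : ℚ) * ∑ i, (zmodRep b i : ℚ) * x.2 i +
          m * ∑ i, ((0 : Fin g → ℤ) i : ℚ) * zmodRep b i =
          ((N * ∑ i, r x i * (b i).val : ℤ) : ℚ) := by
        push_cast
        simp only [hr x ((hX x).mp hx).2, zmodRep]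
        simp [mul_comm]
      rw [h1, Int.floor_intCast, _root_.zpow_mul, zpow_natCast]
      change η ^ _ = _
      rw [zpow_finset_sum]
      exact Finset.prod_congr rfl fun i _ => by rw [_root_.zpow_mul, zpow_natCast]
    · rw [hX]
      exact ⟨fun h => ⟨h, left_ne_zero_of_mul hx⟩, fun h => h.1⟩
  -- Sum against the inverse of the character of index `R`.
  have hsum : ∑ b : Fin g → ZMod N,
      ((∏ i, ((η ^ r (T, R) i)⁻¹) ^ (b i).val : (Op p)ˣ) : Op p) *
        (φ.torsionSeries N ζ 0 (zmodRep b)).coeff n = (N : Op p) ^ g * φ.coeff T R := by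
    have h1 : ∀ b : Fin g → ZMod N,
        ((∏ i, ((η ^ r (T, R) i)⁻¹) ^ (b i).val : (Op p)ˣ) : Op p) *
          (φ.torsionSeries N ζ 0 (zmodRep b)).coeff n =
        ∑ x ∈ X, φ.coeff x.1 x.2 *
          ∏ i, (((η ^ (r x i - r (T, R) i) : (Op p)ˣ) : Op p)) ^ (b i).val := by
      intro b
      rw [hcoeff, Finset.mul_sum]
      refine Finset.sum_congr rfl fun x _ => ?_
      rw [mul_left_comm, ← Units.val_mul, ← Finset.prod_mul_distrib]
      congr 1
      push_cast
      refine Finset.prod_congr rfl fun i _ => ?_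
      rw [_root_.zpow_sub, Units.val_mul, mul_pow, mul_comm]
    rw [Finset.sum_congr rfl fun b _ => h1 b, Finset.sum_comm,
      Finset.sum_eq_single (T, R) (fun x hx hne => ?_)
        (fun hn => absurd ((hX (T, R)).mpr ⟨rfl, hTR⟩) hn)]
    · simp [mul_comm]
    · rw [← Finset.mul_sum]
      refine mul_eq_zero_of_right _ (sum_prod_pow_eq_zero _ (fun i => ?_) ?_)
      · rw [← Units.val_pow_eq_pow_val, ← zpow_natCast, ← _root_.zpow_mul, mul_comm, _root_.zpow_mul,
          zpow_natCast, hη.pow_eq_one, _root_.one_zpow, Units.val_one]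
      · -- The indices in `X` differ by less than `N`, so that `η` separates them.
        have hxT := hXT x hx
        have hxc := ((hX x).mp hx).2
        have hxR : ∃ i, r x i ≠ r (T, R) i := by
          by_contra! h2
          refine hne (Prod.ext hxT (funext fun i => ?_))
          rw [hr x hxc, h2, ← hr (T, R) hTR]
        obtain ⟨i, hi⟩ := hxR
        refine ⟨i, fun h2 => hi ?_⟩
        have h3 := (hη.zpow_eq_one_iff_dvd _).mp (Units.val_eq_one.mp h2)
        have hbd : ∀ y : Matrix (Fin g) (Fin g) ℚ × (Fin g → ℚ), φ.coeff y.1 y.2 ≠ 0 → y.1 = T →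
            |(r y i : ℚ)| ≤ 4 * m * |T i i| + 1 := by
          intro y hy hyT
          have h4 := sq_le_of_coeff_ne_zero hy i
          rw [hr y hy, hyT] at h4
          have h5 : 4 * m * T i i ≤ 4 * m * |T i i| := by gcongr; exact le_abs_self _
          nlinarith [abs_mul_abs_self (r y i : ℚ), abs_nonneg (r y i : ℚ)]
        have h6 : |((r x i - r (T, R) i : ℤ) : ℚ)| < N := by
          push_cast
          calc |(r x i : ℚ) - r (T, R) i| ≤ |(r x i : ℚ)| + |(r (T, R) i : ℚ)| := abs_sub _ _
            _ ≤ 2 * (4 * m * |T i i| + 1) := by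
                linarith [hbd x hxc hxT, hbd (T, R) hTR rfl]
            _ < N := hT i
        have h7 : |r x i - r (T, R) i| < N := by exact_mod_cast h6
        exact sub_eq_zero.mp (Int.eq_zero_of_abs_lt_dvd h3 h7)
  have hmem : (N : Op p) ^ g * φ.coeff T R ∈ primeP p := by
    rw [← hsum]
    exact Ideal.sum_mem _ fun b _ => Ideal.mul_mem_left _ _ (h b n)
  have hprime : (primeP p).IsPrime := (IsLocalRing.maximalIdeal.isMaximal (Op p)).isPrime
  exact (hprime.mem_or_mem hmem).resolve_left fun h1 => hNp (hprime.mem_of_pow_mem g h1)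

end Vanishing

end SturmSlope

end

theorem mainTheorem5 (p : ℕ) [Fact p.Prime] (ι : SturmSlope.Qpur p →+* ℂ)
    (g k m : ℕ) (hg : 1 ≤ g) (hk : 1 ≤ k) (hm : 1 ≤ m)
    (hρ : 0 < SturmSlope.diagSlopeBound p ι g)
    (φ : SturmSlope.JacobiForm p ι g k m)
    (hφ : (m : ENNReal) / 4 + (k : ENNReal) / SturmSlope.diagSlopeBound p ι g <
      (φ.diagOrd : ENNReal)) :
    φ.IsZeroMod := by
  open SturmSlope in
  have hp : p.Prime := Fact.out
  rw [JacobiForm.diagOrd, ENat.toENNReal_iSup] at hφ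
  simp only [ENat.toENNReal_iSup] at hφ
  obtain ⟨l, hlt⟩ := lt_iSup_iff.mp hφ
  obtain ⟨hl, hlt⟩ := lt_iSup_iff.mp hlt
  rw [ENat.toENNReal_coe] at hlt
  intro T R
  -- `N` is large compared to `T` and congruent to `1` modulo `p`.
  obtain ⟨B, hB⟩ := exists_nat_gt (∑ i, 2 * (4 * m * |T i i| + 1))
  let N := 1 + p * B
  have hN : N ≠ 0 := by simp [N]
  have hcop : p.Coprime (N ^ 2) := by
    refine Nat.Coprime.pow_right 2 ?_
    simp [N]
  obtain ⟨ζ, hζ, hιζ⟩ := exists_rootOfUnity ι hcop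
  have hN2 : N ^ 2 ≠ 0 := pow_ne_zero 2 hN
  refine φ.coeff_mem_of_torsionSeries hm hN (hζ.isUnit_unit hN2) (fun hmem => ?_) (fun b n => ?_)
    T R fun i => ?_
  · have h1 : (1 : Op p) ∈ primeP p := by
      have h2 := Ideal.sub_mem _ hmem (Ideal.mul_mem_right (B : Op p) _ natCast_mem_primeP)
      simpa [N] using h2
    exact (Ideal.ne_top_iff_one _).mp (IsLocalRing.maximalIdeal.isMaximal (Op p)).ne_top h1
  · have := φ.coeff_torsionSeries_mem_of_slope hk hm hl hρ hlt hN
      (ζ := (hζ.isUnit hN2).unit) hιζ (Sum.elim 0 b) n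
    have h0 : zmodRep (N := N) (fun i : Fin g => Sum.elim (0 : Fin g → ZMod N) b (.inl i)) = 0 := by
      ext; simp [zmodRep]
    rwa [h0] at this
  · calc 2 * (4 * m * |T i i| + 1) ≤ ∑ i, 2 * (4 * m * |T i i| + 1) :=
          Finset.single_le_sum (f := fun i => 2 * (4 * m * |T i i| + 1))
            (fun i _ => by positivity) (Finset.mem_univ i)
      _ ≤ B := hB.le
      _ < N := by
        have h1 : B < N := by
          have := Nat.le_mul_of_pos_left B hp.pos
          omega
        exact_mod_cast h1
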